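/- **Setting.** Let $\Gamma\subset \mathrm{SL}_2(\mathbf R)$ be a Fuchsian group of the first kind (a discrete subgroup such that the quotient by $\Gamma$ of the union of the upper half-plane $\mathbf H$ and the cusps of $\Gamma$ is compact) for which $\Gamma\backslash\mathbf H$ has finite hyperbolic area and is not compact. Fix representatives $\mathfrak a,\mathfrak b,\dots$ of the finitely many $\Gamma$-inequivalent cusps, and scaling matrices $\sigma_{\mathfrak a}\in \mathrm{SL}_2(\mathbf R)$, so that $\sigma_{\mathfrak a}\infty=\mathfrak a$ and, modulo $\pm I$, $\sigma_{\mathfrak a}^{-1}\Gamma_{\mathfrak a}\sigma_{\mathfrak a}=\{\left(\begin{smallmatrix}1&k\\0&1\end{smallmatrix}\right):k\in\mathbf Z\}$, where $\Gamma_{\mathfrak a}$ is the stabilizer of $\mathfrak a$ in $\Gamma$. Let $f,g$ be holomorphic cusp forms of weight $2$ for $\Gamma$, and put $\langle\gamma,f\rangle=\int_{z_0}^{\gamma z_0}f(w)\,dw$ for $\gamma\in\Gamma$, which does not depend on $z_0\in\mathbf H$. For a cusp representative $\mathfrak a$, a unitary character $\chi$ of $\Gamma$ that is trivial on $\Gamma_{\mathfrak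 a}$, and integers $m,n\ge 0$, consider the series $$E^{m,n}_{\mathfrak a}(z,s)=\sum_{\gamma\in\Gamma_{\mathfrak a}\backslash\Gamma}\chi(\gamma)\,\langle\gamma,f\rangle^m\,\overline{\langle\gamma,g\rangle}^{\,n}\,\mathrm{Im}(\sigma_{\mathfrak a}^{-1}\gamma z)^s\qquad(z\in\mathbf H,\ s\in\mathbf C).$$ Let $\mathbf F\subset\mathbf H$ be a fundamental domain for $\Gamma$ (it meets every $\Gamma$-orbit, and distinct points of its interior are inequivalent) that, for some $Y>0$, contains all cuspidal zones $\sigma_{\mathfrak a}\{x+iy:|x|\le\tfrac12,\ y\ge Y\}$ and is contained in the union of these zones and a compact subset of $\mathbf H$. For $z\in\mathbf F$ put $y_{\mathbf F}(z)=\max_{\mathfrak a}\mathrm{Im}(\sigma_{\mathfrak a}^{-1}z)$. **Proposition 3.3.** Let $m,n\ge0$ with $(m,n)\neq(0,0)$. 1. The terms of the series are well defined: they depend only on the coset $\Gamma_{\mathfrak a}\gamma$. The series converges absolutely for all $z\in\mathbf H$ and all $s\in\mathbf C$ with $\mathrm{Re}(s)>1$, and for every $\delta>0$ it converges uniformly in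 the region $\mathrm{Re}(s)\ge1+\delta$, uniformly also for $z$ in compact subsets of $\mathbf H$. 2. For fixed $s$ with $\mathrm{Re}(s)>1$, $E^{m,n}_{\mathfrak a}(z,s)$ is a $C^\infty$ function of $z\in\mathbf H$. For fixed $z\in\mathbf H$ it is a holomorphic function of $s$ in $\mathrm{Re}(s)>1$. 3. For every $\sigma>1$ and every $\varepsilon>0$ there is a constant $A$, which depends only on $\varepsilon,\sigma,m,n,f,g$ and $\Gamma$ (with its fixed cusp representatives, scaling matrices and $\mathbf F$), such that $$|E^{m,n}_{\mathfrak a}(z,s)|\le A\,y_{\mathbf F}(z)^{1-\sigma+\varepsilon}$$ for all cusp representatives $\mathfrak a$, all $\chi$ as above, all $s$ with $\mathrm{Re}(s)=\sigma$ and all $z\in\mathbf F$. -/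

import Mathlib

open Matrix UpperHalfPlane MeasureTheory Filter
open scoped MatrixGroups ContDiff ComplexConjugate

noncomputable section

/-- The action of `SL(2, ℝ)` on the boundary `ℝ ∪ {∞}` of the upper half-plane by fractional
linear transformations. -/
def boundaryAct (g : SL(2, ℝ)) (c : OnePoint ℝ) : OnePoint ℝ :=
  SpecialLinearGroup.toGL g • c

/-- A subgroup of `SL(2, ℝ)` regarded as a subgroup of `GL(2, ℝ)`, the form in which Mathlib's
theory of cusps and cusp forms expects it. -/
abbrev glImage (Γ : Subgroup SL(2, ℝ)) : Subgroup (GL (Fin 2) ℝ) :=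
  Γ.map SpecialLinearGroup.toGL

/-- The horoball `g {z | Im z > Y}` at the boundary point `g ∞`. -/
def horoball (g : SL(2, ℝ)) (Y : ℝ) : Set ℍ := {z | Y < (g⁻¹ • z).im}

/-- `Γ ⊂ SL(2, ℝ)` is a Fuchsian group of the first kind whose quotient `Γ \ ℍ` has finite volume
and is not compact.

"First kind" means: the quotient by `Γ` of `ℍ* = ℍ ∪ {cusps of Γ}`, in which the horoballs are the
neighbourhoods of the cusps, is compact. Spelled out: there are finitely many cusps, up to
`Γ`-equivalence, and the complement of arbitrarily small horoballs at them is compact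
modulo `Γ`. -/
structure IsCofiniteFuchsian (Γ : Subgroup SL(2, ℝ)) : Prop where
  discrete : DiscreteTopology Γ
  firstKind : ∃ S : Finset SL(2, ℝ),
    (∀ g ∈ S, IsCusp (boundaryAct g OnePoint.infty) (glImage Γ)) ∧
    (∀ c : OnePoint ℝ, IsCusp c (glImage Γ) →
      ∃ γ ∈ Γ, ∃ g ∈ S, boundaryAct γ c = boundaryAct g OnePoint.infty) ∧
    ∀ Y : ℝ, ∃ K : Set ℍ, IsCompact K ∧
      ∀ z : ℍ, ∃ γ ∈ Γ, γ • z ∈ K ∪ ⋃ g ∈ S, horoball g Y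
  finiteVolume : ∃ D : Set ℍ, MeasurableSet D ∧ (∀ z : ℍ, ∃ γ ∈ Γ, γ • z ∈ D) ∧ volume D < ⊤
  noncompact : ¬ ∃ K : Set ℍ, IsCompact K ∧ ∀ z : ℍ, ∃ γ ∈ Γ, γ • z ∈ K

/-- The subgroup `Γ_c` of the elements of `Γ` that fix the boundary point `c`. -/
def cuspStabilizer (Γ : Subgroup SL(2, ℝ)) (c : OnePoint ℝ) : Subgroup Γ :=
  (MulAction.stabilizer (GL (Fin 2) ℝ) c).comap (SpecialLinearGroup.toGL.comp Γ.subtype)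

/-- The matrix `(1 x; 0 1)`. -/
def translation (x : ℝ) : SL(2, ℝ) := ⟨!![1, x; 0, 1], by simp⟩

/-- `σ` is a scaling matrix for the cusp `𝔞 = σ ∞` of `Γ`: up to signs, that is in `PSL(2, ℝ)`,
the group `σ⁻¹ Γ_𝔞 σ` consists of the translations by integers. -/
structure IsScalingMatrix (Γ : Subgroup SL(2, ℝ)) (σ : SL(2, ℝ)) : Prop where
  translation_mem : ∀ n : ℤ, ∃ γ ∈ Γ,
    σ⁻¹ * γ * σ = translation n ∨ σ⁻¹ * γ * σ = -translation n
  eq_translation : ∀ γ ∈ Γ,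
    boundaryAct γ (boundaryAct σ OnePoint.infty) = boundaryAct σ OnePoint.infty →
    ∃ n : ℤ, σ⁻¹ * γ * σ = translation n ∨ σ⁻¹ * γ * σ = -translation n

/-- A complete system of inequivalent cusps of `Γ`, labelled by `ι`, with scaling matrices. -/
structure CuspSystem (Γ : Subgroup SL(2, ℝ)) (ι : Type*) where
  /-- The scaling matrix `σ_𝔞` of the cusp with label `𝔞`. -/
  scaling : ι → SL(2, ℝ)
  isScalingMatrix : ∀ 𝔞, IsScalingMatrix Γ (scaling 𝔞)
  complete : ∀ c : OnePoint ℝ, IsCusp c (glImage Γ) →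
    ∃ γ ∈ Γ, ∃ 𝔞, boundaryAct γ c = boundaryAct (scaling 𝔞) OnePoint.infty
  inequivalent : ∀ 𝔞 𝔟, ∀ γ ∈ Γ,
    boundaryAct γ (boundaryAct (scaling 𝔞) OnePoint.infty) =
      boundaryAct (scaling 𝔟) OnePoint.infty → 𝔞 = 𝔟

namespace CuspSystem

variable {Γ : Subgroup SL(2, ℝ)} {ι : Type*}

/-- The cusp `σ_𝔞 ∞` with label `𝔞`. -/
def cusp (C : CuspSystem Γ ι) (𝔞 : ι) : OnePoint ℝ :=
  boundaryAct (C.scaling 𝔞) OnePoint.infty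

/-- The group `Γ_𝔞`, the stabilizer in `Γ` of the cusp with label `𝔞`. -/
def stab (C : CuspSystem Γ ι) (𝔞 : ι) : Subgroup Γ := cuspStabilizer Γ (C.cusp 𝔞)

/-- The height `max_𝔞 Im (σ_𝔞⁻¹ z)`. -/
def height (C : CuspSystem Γ ι) (z : ℍ) : ℝ := ⨆ 𝔞, ((C.scaling 𝔞)⁻¹ • z).im

/-- The cuspidal zone `σ_𝔞 P_Y`, where `P_Y` is the strip `|x| ≤ 1/2`, `y ≥ Y`. -/
def zone (C : CuspSystem Γ ι) (𝔞 : ι) (Y : ℝ) : Set ℍ :=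
  {z | |((C.scaling 𝔞)⁻¹ • z).re| ≤ 1 / 2 ∧ Y ≤ ((C.scaling 𝔞)⁻¹ • z).im}

/-- `F` is a fundamental domain for `Γ` that is the union of a relatively compact set and of the
cuspidal zones `σ_𝔞 P_Y` for some (equivalently, for every large enough) `Y`. -/
structure IsFundamentalDomain (C : CuspSystem Γ ι) (F : Set ℍ) : Prop where
  covers : ∀ z : ℍ, ∃ γ ∈ Γ, γ • z ∈ F
  interior_inequivalent : ∀ z ∈ interior F, ∀ γ ∈ Γ, γ • z ∈ interior F → γ • z = z
  zones : ∃ Y : ℝ, 0 < Y ∧ (∀ 𝔞, C.zone 𝔞 Y ⊆ F) ∧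
    ∃ K : Set ℍ, IsCompact K ∧ F ⊆ K ∪ ⋃ 𝔞, C.zone 𝔞 Y

end CuspSystem

/-- The modular symbol `⟨γ, f⟩`, the integral of `f(w) dw` from `z₀` to `γ z₀`, taken along the
straight segment and with `z₀ = i`. -/
def modularSymbol (f : ℍ → ℂ) (γ : SL(2, ℝ)) : ℂ :=
  ∫ t in (0 : ℝ)..1,
    f (ofComplex ((I : ℂ) + t * (((γ • I : ℍ) : ℂ) - (I : ℂ)))) *
      (((γ • I : ℍ) : ℂ) - (I : ℂ))

section Eisenstein

variable {Γ : Subgroup SL(2, ℝ)} {ι : Type*}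

/-- The summand `χ(γ) ⟨γ, f⟩ ^ m conj(⟨γ, g⟩) ^ n Im(σ_𝔞⁻¹ γ z) ^ s`. -/
def eisensteinSummand (C : CuspSystem Γ ι) (f g : ℍ → ℂ) (χ : Γ →* Circle) (m n : ℕ) (𝔞 : ι)
    (γ : Γ) (z : ℍ) (s : ℂ) : ℂ :=
  (χ γ : ℂ) * modularSymbol f γ ^ m * conj (modularSymbol g γ) ^ n *
    ((((C.scaling 𝔞)⁻¹ • ((γ : SL(2, ℝ)) • z) : ℍ).im : ℝ) : ℂ) ^ s

/-- The space `Γ_𝔞 \ Γ` of cosets `Γ_𝔞 γ`. -/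
abbrev CuspCoset (C : CuspSystem Γ ι) (𝔞 : ι) : Type :=
  Quotient (QuotientGroup.rightRel (C.stab 𝔞))

/-- The term of the Eisenstein series that belongs to a coset in `Γ_𝔞 \ Γ`, computed with a
representative. -/
def eisensteinTerm (C : CuspSystem Γ ι) (f g : ℍ → ℂ) (χ : Γ →* Circle) (m n : ℕ) (𝔞 : ι)
    (q : CuspCoset C 𝔞) (z : ℍ) (s : ℂ) : ℂ :=
  eisensteinSummand C f g χ m n 𝔞 q.out z s

/-- The higher-order Eisenstein series `E_𝔞^{m,n}(z, s; f, g, χ)`. -/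
def higherEisenstein (C : CuspSystem Γ ι) (f g : ℍ → ℂ) (χ : Γ →* Circle) (m n : ℕ) (𝔞 : ι)
    (z : ℍ) (s : ℂ) : ℂ :=
  ∑' q : CuspCoset C 𝔞, eisensteinTerm C f g χ m n 𝔞 q z s

end Eisenstein

end

/-! The modular symbols are so small that the series behaves like an ordinary Eisenstein series with
a slightly smaller exponent.

Counting: by Shimizu's lemma (`lowerLeft_eq_zero_or_half_le`), the lower rows attached to distinct
cosets have pairwise determinants at least `1 / 2`. Hence `O(1 / t + 1)` cosets have height `Im
(σ_𝔞⁻¹ γ z) ≥ t` (`card_le_of_le_translateIm`), and dyadic summation (`sum_rpow_le_of_card_le`)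
gives convergence of `∑ Im (σ_𝔞⁻¹ γ z) ^ σ` for `σ > 1`.

Symbols: a primitive `F` of `f` satisfies `F (γ z) - F z = ⟨γ, f⟩` (`segmentPrimitive_smul_sub`). As
`y |f|` is bounded and `f` decays at the cusps, `F (σ_𝔞 w)` is `O(max 1 ((Im w) ^ (-ε)))` for every
`ε > 0`. So `⟨γ, f⟩` costs only an arbitrarily small negative power of the height
(`exists_norm_modularSymbol_le`), and absolute and uniform convergence follow, hence holomorphy in
`s`.

Smoothness: `Im (g z) ^ s` is `Im z ^ s` times a holomorphic and an antiholomorphic factor, and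
Cauchy's estimates allow repeated termwise differentiation (`contDiffOn_tsum_im_smul_cpow`).

Growth: at height `y` in the zone of `𝔟`, every term has height at most `4 / y`, except that of the
coset `Γ_𝔞` when `𝔟 = 𝔞`. There the symbols vanish and `(m, n) ≠ (0, 0)`, so the would-be main term
`y ^ σ` is absent. Dyadic summation over the others gives `y ^ (1 - σ + ε)`
(`exists_tsum_le_of_zone`). -/

open scoped Topology ModularForm Manifold

/-! ### Lower rows of matrices in `SL(2, ℝ)` -/

lemma im_smul_eq_div_normSq_lowerRow (g : SL(2, ℝ)) (z : ℍ) :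
    (g • z).im = z.im / Complex.normSq ((g 1 0 : ℂ) * z + g 1 1) := by
  have h := UpperHalfPlane.im_smul_eq_div_normSq (Matrix.SpecialLinearGroup.toGL g) z
  rw [show g • z = Matrix.SpecialLinearGroup.toGL g • z from rfl, h]
  simp [denom]

lemma im_smul_I (g : SL(2, ℝ)) : (g • (I : ℍ)).im = 1 / (g 1 0 ^ 2 + g 1 1 ^ 2) := by
  rw [im_smul_eq_div_normSq_lowerRow]
  simp [Complex.normSq_apply, pow_two, add_comm]

lemma sl_mul_apply (g h : SL(2, ℝ)) (i j : Fin 2) :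
    (g * h) i j = g i 0 * h 0 j + g i 1 * h 1 j := by
  have := congrFun (congrFun (Matrix.SpecialLinearGroup.coe_mul g h) i) j
  rw [Matrix.mul_apply, Fin.sum_univ_two] at this
  exact this

lemma sl_inv_val (g : SL(2, ℝ)) : (g⁻¹).1 = !![g 1 1, -g 0 1; -g 1 0, g 0 0] := by
  exact (Matrix.SpecialLinearGroup.coe_inv g).trans (adjugate_fin_two _)

lemma sl_mul_inv_lowerLeft (g h : SL(2, ℝ)) :
    (h * g⁻¹) 1 0 = h 1 0 * g 1 1 - h 1 1 * g 1 0 := by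
  rw [sl_mul_apply, sl_inv_val]
  simp
  ring

lemma boundaryAct_mul (g h : SL(2, ℝ)) (c : OnePoint ℝ) :
    boundaryAct (g * h) c = boundaryAct g (boundaryAct h c) := by
  simp [boundaryAct, mul_smul]

lemma boundaryAct_infty_eq_infty_iff (g : SL(2, ℝ)) :
    boundaryAct g OnePoint.infty = OnePoint.infty ↔ g 1 0 = 0 := by
  rw [boundaryAct, OnePoint.smul_infty_eq_self_iff]
  simp

lemma boundaryAct_infty_eq_iff (g h : SL(2, ℝ)) :
    boundaryAct g OnePoint.infty = boundaryAct h OnePoint.infty ↔ (h⁻¹ * g) 1 0 = 0 := by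
  rw [← boundaryAct_infty_eq_infty_iff, boundaryAct_mul]
  constructor
  · intro e
    rw [e, ← boundaryAct_mul]
    simp [boundaryAct]
  · intro e
    have := congrArg (boundaryAct h) e
    rw [← boundaryAct_mul, mul_inv_cancel] at this
    simpa [boundaryAct] using this

lemma neg_translation_val (x : ℝ) : (-translation x).1 = !![-1, -x; 0, -1] := by
  refine (Matrix.SpecialLinearGroup.coe_neg _).trans ?_
  ext i j
  fin_cases i <;> fin_cases j <;> simp [translation]

/-! ### Shimizu's lemma -/

lemma translation_add (x y : ℝ) : translation (x + y) = translation x * translation y := by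
  ext i j
  rw [sl_mul_apply]
  fin_cases i <;> fin_cases j <;> simp [translation, add_comm]

/-- The unit translation is available only up to sign; squaring removes the sign. This is why
translation by 2 is used throughout. -/
lemma IsScalingMatrix.translation_two_mem {Γ : Subgroup SL(2, ℝ)} {σ : SL(2, ℝ)}
    (h : IsScalingMatrix Γ σ) : σ * translation 2 * σ⁻¹ ∈ Γ := by
  obtain ⟨γ, hγ, e⟩ := h.translation_mem 1
  have : σ * translation 2 * σ⁻¹ = γ * γ := by
    have h2 : translation 2 = (σ⁻¹ * γ * σ) * (σ⁻¹ * γ * σ) := by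
      rw [show (2 : ℝ) = (1 : ℤ) + (1 : ℤ) by norm_num, translation_add]
      rcases e with e | e <;> simp [e]
    rw [h2]; group
  exact this ▸ Γ.mul_mem hγ hγ

lemma conj_translation_two (A : SL(2, ℝ)) :
    (A * translation 2 * A⁻¹ : SL(2, ℝ)).1 =
      !![1 - 2 * A 0 0 * A 1 0, 2 * A 0 0 ^ 2; -2 * A 1 0 ^ 2, 1 + 2 * A 0 0 * A 1 0] := by
  have hdet : A 0 0 * A 1 1 - A 0 1 * A 1 0 = 1 := by
    have := A.2; rwa [Matrix.det_fin_two] at this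
  ext i j
  rw [sl_mul_apply, sl_mul_apply, sl_mul_apply, sl_inv_val]
  fin_cases i <;> fin_cases j <;> simp [translation] <;> grind

/-- The sequence `A, A T² A⁻¹, …` of Shimizu's lemma. -/
noncomputable def shimizuSeq (A : SL(2, ℝ)) : ℕ → SL(2, ℝ)
  | 0 => A
  | n + 1 => shimizuSeq A n * translation 2 * (shimizuSeq A n)⁻¹

lemma shimizuSeq_succ_val (A : SL(2, ℝ)) (n : ℕ) :
    (shimizuSeq A (n + 1)).1 = !![1 - 2 * shimizuSeq A n 0 0 * shimizuSeq A n 1 0,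
      2 * shimizuSeq A n 0 0 ^ 2; -2 * shimizuSeq A n 1 0 ^ 2,
      1 + 2 * shimizuSeq A n 0 0 * shimizuSeq A n 1 0] :=
  conj_translation_two _

/-- The recursion `c ↦ -2 c ^ 2` contracts by the factor `2 |c₀| < 1` at each step. -/
lemma abs_shimizuSeq_lowerLeft_le {A : SL(2, ℝ)} (h1 : |A 1 0| < 1 / 2) (n : ℕ) :
    |shimizuSeq A n 1 0| ≤ (2 * |A 1 0|) ^ n * |A 1 0| := by
  induction n with
  | zero => simp [shimizuSeq]
  | succ n ih =>
    have e : shimizuSeq A (n + 1) 1 0 = -2 * shimizuSeq A n 1 0 ^ 2 := by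
      rw [shimizuSeq_succ_val]; simp
    have h0 : 0 ≤ |A 1 0| := abs_nonneg _
    have ih2 : |shimizuSeq A n 1 0| ≤ |A 1 0| := by
      refine ih.trans (mul_le_of_le_one_left h0 (pow_le_one₀ (by linarith) (by linarith)))
    rw [e, abs_mul, abs_neg, abs_pow, pow_two, abs_two]
    calc 2 * (|shimizuSeq A n 1 0| * |shimizuSeq A n 1 0|)
        ≤ 2 * (((2 * |A 1 0|) ^ n * |A 1 0|) * |A 1 0|) := by gcongr
      _ = _ := by ring

lemma shimizuSeq_lowerLeft_ne_zero {A : SL(2, ℝ)} (h0 : A 1 0 ≠ 0) (n : ℕ) :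
    shimizuSeq A n 1 0 ≠ 0 := by
  induction n with
  | zero => simpa [shimizuSeq]
  | succ n ih =>
    have e : shimizuSeq A (n + 1) 1 0 = -2 * shimizuSeq A n 1 0 ^ 2 := by
      rw [shimizuSeq_succ_val]; simp
    rw [e]
    simpa using ih

lemma exists_abs_shimizuSeq_upperLeft_le {A : SL(2, ℝ)} (h1 : |A 1 0| < 1 / 2) :
    ∃ M, ∀ n, |shimizuSeq A n 0 0| ≤ M := by
  set r := 2 * |A 1 0| with hr
  have h0 : 0 ≤ |A 1 0| := abs_nonneg _
  have hr1 : 0 < 1 - r := by linarith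
  -- `1 / (1 - r)` is the fixed point of `x ↦ 1 + r x`, which dominates the recursion `a ↦ 1 - 2 a
  -- c`.
  refine ⟨max |A 0 0| (1 / (1 - r)), fun n ↦ ?_⟩
  induction n with
  | zero => simp [shimizuSeq]
  | succ n ih =>
    have e : shimizuSeq A (n + 1) 0 0 = 1 - 2 * shimizuSeq A n 0 0 * shimizuSeq A n 1 0 := by
      rw [shimizuSeq_succ_val]; simp
    set M := max |A 0 0| (1 / (1 - r)) with hM
    have hM1 : 1 ≤ M * (1 - r) := by
      have := le_max_right |A 0 0| (1 / (1 - r))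
      rwa [← hM, div_le_iff₀ hr1] at this
    have hc : |shimizuSeq A n 1 0| ≤ |A 1 0| := by
      refine (abs_shimizuSeq_lowerLeft_le h1 n).trans
        (mul_le_of_le_one_left h0 (pow_le_one₀ (by linarith) (by linarith)))
    have hM0 : 0 ≤ M := le_max_of_le_left (abs_nonneg _)
    rw [e]
    calc |1 - 2 * shimizuSeq A n 0 0 * shimizuSeq A n 1 0|
        ≤ |1| + |2 * shimizuSeq A n 0 0 * shimizuSeq A n 1 0| := abs_sub _ _
      _ = 1 + 2 * (|shimizuSeq A n 0 0| * |shimizuSeq A n 1 0|) := by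
        rw [abs_mul, abs_mul, abs_one, abs_two]; ring
      _ ≤ 1 + 2 * (M * |A 1 0|) := by gcongr
      _ ≤ M := by nlinarith

lemma tendsto_shimizuSeq {A : SL(2, ℝ)} (h1 : |A 1 0| < 1 / 2) :
    Tendsto (shimizuSeq A) atTop (𝓝 (translation 2)) := by
  have h0 : 0 ≤ |A 1 0| := abs_nonneg _
  have hc : Tendsto (fun n ↦ shimizuSeq A n 1 0) atTop (𝓝 0) := by
    refine squeeze_zero_norm (a := fun n ↦ (2 * |A 1 0|) ^ n * |A 1 0|)
      (fun n ↦ abs_shimizuSeq_lowerLeft_le h1 n) ?_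
    simpa using (tendsto_pow_atTop_nhds_zero_of_lt_one (by linarith : 0 ≤ 2 * |A 1 0|)
      (by linarith)).mul_const |A 1 0|
  obtain ⟨M, hM⟩ := exists_abs_shimizuSeq_upperLeft_le h1
  have hac : Tendsto (fun n ↦ shimizuSeq A n 0 0 * shimizuSeq A n 1 0) atTop (𝓝 0) := by
    refine squeeze_zero_norm (a := fun n ↦ M * |shimizuSeq A n 1 0|) (fun n ↦ ?_) ?_
    · rw [Real.norm_eq_abs, abs_mul]
      exact mul_le_mul_of_nonneg_right (hM n) (abs_nonneg _)
    · simpa using hc.abs.const_mul M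
  have ha : Tendsto (fun n ↦ shimizuSeq A n 0 0) atTop (𝓝 1) := by
    rw [← tendsto_add_atTop_iff_nat 1]
    have : (fun n ↦ shimizuSeq A (n + 1) 0 0) =
        fun n ↦ 1 - 2 * (shimizuSeq A n 0 0 * shimizuSeq A n 1 0) := by
      funext n
      rw [shimizuSeq_succ_val, ← mul_assoc]; simp
    rw [this]
    simpa using (hac.const_mul 2).const_sub 1
  rw [← tendsto_add_atTop_iff_nat 1]
  refine tendsto_subtype_rng.2 (tendsto_pi_nhds.2 fun i ↦ ?_)
  rw [tendsto_pi_nhds]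
  intro j
  have key : ∀ n, (shimizuSeq A (n + 1)).1 i j =
      !![1 - 2 * shimizuSeq A n 0 0 * shimizuSeq A n 1 0, 2 * shimizuSeq A n 0 0 ^ 2;
        -2 * shimizuSeq A n 1 0 ^ 2, 1 + 2 * shimizuSeq A n 0 0 * shimizuSeq A n 1 0] i j :=
    fun n ↦ by rw [shimizuSeq_succ_val]
  simp_rw [key]
  fin_cases i <;> fin_cases j <;> simp only [translation, Fin.zero_eta, Fin.isValue, Fin.mk_one,
    of_apply, cons_val', cons_val_zero, cons_val_fin_one, cons_val_one]
  · simpa [mul_assoc] using (hac.const_mul 2).const_sub 1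
  · simpa using (ha.pow 2).const_mul 2
  · simpa using (hc.pow 2).const_mul (-2)
  · simpa [mul_assoc] using (hac.const_mul 2).const_add 1

/-- **Shimizu's lemma**, with a constant `1 / 2` in the place of the optimal `1`. -/
theorem lowerLeft_eq_zero_or_half_le {Γ : Subgroup SL(2, ℝ)} (hd : DiscreteTopology Γ)
    {σ : SL(2, ℝ)} (hσ : σ * translation 2 * σ⁻¹ ∈ Γ) {γ : SL(2, ℝ)} (hγ : γ ∈ Γ) :
    (σ⁻¹ * γ * σ) 1 0 = 0 ∨ 1 / 2 ≤ |(σ⁻¹ * γ * σ) 1 0| := by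
  by_contra! hcon
  obtain ⟨hne, hlt⟩ := hcon
  set A := σ⁻¹ * γ * σ with hA
  have hmem : ∀ n, σ * shimizuSeq A n * σ⁻¹ ∈ Γ := by
    intro n
    induction n with
    | zero => simpa [shimizuSeq, hA, mul_assoc] using hγ
    | succ n ih =>
      have := Γ.mul_mem (Γ.mul_mem ih hσ) (Γ.inv_mem ih)
      convert this using 1
      simp [shimizuSeq, mul_assoc]
  have hlim : Tendsto (fun n ↦ σ * shimizuSeq A n * σ⁻¹) atTop
      (𝓝 (σ * translation 2 * σ⁻¹)) :=
    ((tendsto_shimizuSeq hlt).const_mul σ).mul_const σ⁻¹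
  have hlim' : Tendsto (fun n ↦ (⟨_, hmem n⟩ : Γ)) atTop (𝓝 ⟨_, hσ⟩) :=
    tendsto_subtype_rng.2 hlim
  -- In a discrete group the convergent sequence is eventually constant, so some lower left entry is
  -- 0, although none of them can vanish.
  rw [nhds_discrete, tendsto_pure] at hlim'
  obtain ⟨n, hn⟩ := hlim'.exists
  have h2 : shimizuSeq A n = translation 2 := by
    have := congrArg Subtype.val hn
    simpa using this
  exact shimizuSeq_lowerLeft_ne_zero hne n (by simp [h2, translation])

/-! ### Counting vectors with large pairwise determinants -/

lemma card_le_of_separated {α : Type*} (s : Finset α) (t : α → ℝ) {R : ℝ} (hR : 0 ≤ R)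
    (ht : ∀ q ∈ s, |t q| ≤ R) (hsep : ∀ q ∈ s, ∀ q' ∈ s, q ≠ q' → 1 ≤ |t q - t q'|) :
    (s.card : ℝ) ≤ 2 * R + 2 := by
  have hinj : Set.InjOn (fun q ↦ ⌊t q⌋) s := by
    intro q hq q' hq' e
    by_contra hne
    have := Int.abs_sub_lt_one_of_floor_eq_floor e
    linarith [hsep q hq q' hq' hne]
  have hmap : ∀ q ∈ s, ⌊t q⌋ ∈ Finset.Icc (⌊-R⌋) (⌊R⌋) := by
    intro q hq
    have := abs_le.1 (ht q hq)
    exact Finset.mem_Icc.2 ⟨Int.floor_le_floor this.1, Int.floor_le_floor this.2⟩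
  have hcard := Finset.card_le_card_of_injOn _ hmap hinj
  rw [Int.card_Icc] at hcard
  have h1 : (s.card : ℝ) ≤ ((⌊R⌋ + 1 - ⌊-R⌋).toNat : ℝ) := by exact_mod_cast hcard
  have h2 : ((⌊R⌋ + 1 - ⌊-R⌋).toNat : ℝ) = (⌊R⌋ : ℝ) + 1 - ⌊-R⌋ := by
    have : 0 ≤ ⌊R⌋ + 1 - ⌊-R⌋ := by
      have : ⌊-R⌋ ≤ ⌊R⌋ := Int.floor_le_floor (by linarith)
      omega
    exact_mod_cast congrArg (Int.cast (R := ℝ)) (Int.toNat_of_nonneg this)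
  have h3 := Int.floor_le R
  have h4 := Int.lt_floor_add_one (-R)
  linarith

/-- The slopes `c / d` lie in `[-1, 1]`, and two of them differ by determinant over `d d'`, hence by
at least `1 / (2 T)`. Scaled by `2 T` they are 1-separated. -/
lemma card_le_of_wedge_of_abs_le {α : Type*} (s : Finset α) (c d : α → ℝ) {T : ℝ} (hT0 : 0 ≤ T)
    (hd0 : ∀ q ∈ s, d q ≠ 0) (hcd : ∀ q ∈ s, |c q| ≤ |d q|) (hT : ∀ q ∈ s, d q ^ 2 ≤ T)
    (hsep : ∀ q ∈ s, ∀ q' ∈ s, q ≠ q' → 1 / 2 ≤ |c q * d q' - d q * c q'|) :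
    (s.card : ℝ) ≤ 4 * T + 2 := by
  have := card_le_of_separated s (fun q ↦ 2 * T * (c q / d q)) (R := 2 * T) (by positivity) ?_ ?_
  · linarith
  · intro q hq
    rw [abs_mul, abs_div, abs_of_nonneg (by positivity : 0 ≤ 2 * T)]
    exact mul_le_of_le_one_right (by positivity)
      (div_le_one_of_le₀ (hcd q hq) (abs_nonneg _))
  · intro q hq q' hq' hne
    have e : 2 * T * (c q / d q) - 2 * T * (c q' / d q') =
        2 * T * ((c q * d q' - d q * c q') / (d q * d q')) := by
      have := hd0 q hq
      have := hd0 q' hq'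
      field_simp
    have hpos : 0 < |d q * d q'| := abs_pos.2 (mul_ne_zero (hd0 q hq) (hd0 q' hq'))
    have hle : |d q * d q'| ≤ T := by
      rw [abs_mul]
      nlinarith [sq_nonneg (|d q| - |d q'|), sq_abs (d q), sq_abs (d q'), hT q hq, hT q' hq']
    rw [e, abs_mul, abs_div, abs_of_nonneg (by positivity : 0 ≤ 2 * T), mul_div_assoc',
      le_div_iff₀ hpos]
    nlinarith [hsep q hq q' hq' hne]

/-- Vectors `(c, d)` of square length at most `T` with pairwise determinants at least `1 / 2` are
`O(T + 1)` in number. -/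
lemma card_le_of_wedge {α : Type*} (s : Finset α) (c d : α → ℝ) {T : ℝ} (hT0 : 0 ≤ T)
    (h0 : ∀ q ∈ s, 0 < c q ^ 2 + d q ^ 2) (hT : ∀ q ∈ s, c q ^ 2 + d q ^ 2 ≤ T)
    (hsep : ∀ q ∈ s, ∀ q' ∈ s, q ≠ q' → 1 / 2 ≤ |c q * d q' - d q * c q'|) :
    (s.card : ℝ) ≤ 8 * T + 4 := by
  classical
  have h1 := card_le_of_wedge_of_abs_le (s.filter fun q ↦ |c q| ≤ |d q|) c d hT0 ?_ ?_ ?_ ?_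
  · have h2 := card_le_of_wedge_of_abs_le (s.filter fun q ↦ ¬ |c q| ≤ |d q|) d c hT0 ?_ ?_ ?_ ?_
    · have : (s.card : ℝ) = ((s.filter fun q ↦ |c q| ≤ |d q|).card : ℝ) +
          ((s.filter fun q ↦ ¬ |c q| ≤ |d q|).card : ℝ) := by
        exact_mod_cast (Finset.card_filter_add_card_filter_not (s := s) _).symm
      linarith
    · intro q hq e
      simp [e] at hq
      exact absurd hq.2 (abs_nonneg _).not_gt
    · intro q hq
      exact (not_le.1 (Finset.mem_filter.1 hq).2).le
    · intro q hq
      linarith [hT q (Finset.mem_filter.1 hq).1, sq_nonneg (d q)]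
    · intro q hq q' hq' hne
      rw [abs_sub_comm]
      exact hsep q (Finset.mem_filter.1 hq).1 q' (Finset.mem_filter.1 hq').1 hne
  · intro q hq e
    have := h0 q (Finset.mem_filter.1 hq).1
    simp [e] at hq
    simp [e, hq.2] at this
  · intro q hq
    exact (Finset.mem_filter.1 hq).2
  · intro q hq
    linarith [hT q (Finset.mem_filter.1 hq).1, sq_nonneg (c q)]
  · intro q hq q' hq' hne
    exact hsep q (Finset.mem_filter.1 hq).1 q' (Finset.mem_filter.1 hq').1 hne

/-- Dyadic summation: a family with values in `(0, X]` of which at most `B / t` are `≥ t`. -/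
lemma sum_rpow_le_of_card_le {α : Type*} {B X σ : ℝ} (hX : 0 < X) (hσ : 1 < σ)
    (s : Finset α) (y : α → ℝ) (hy0 : ∀ q ∈ s, 0 < y q) (hyX : ∀ q ∈ s, y q ≤ X)
    (hcard : ∀ s' ⊆ s, ∀ t : ℝ, 0 < t → t ≤ X → (∀ q ∈ s', t ≤ y q) → (s'.card : ℝ) ≤ B / t) :
    ∑ q ∈ s, y q ^ σ ≤ B * (2 * (1 - (2 : ℝ) ^ (1 - σ))⁻¹) * X ^ (σ - 1) := by
  classical
  have hB : 0 ≤ B := by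
    have := hcard ∅ (by simp) X hX le_rfl (by simp)
    rw [Finset.card_empty, Nat.cast_zero, le_div_iff₀ hX] at this
    linarith
  have hk : ∀ q ∈ s, ∃ k : ℕ, (1 / 2 : ℝ) ^ (k + 1) < y q / X ∧ y q / X ≤ (1 / 2 : ℝ) ^ k :=
    fun q hq ↦ exists_nat_pow_near_of_lt_one (div_pos (hy0 q hq) hX)
      (div_le_one_of_le₀ (hyX q hq) hX.le) (by norm_num) (by norm_num)
  choose! k hk1 hk2 using hk
  set r : ℝ := (2 : ℝ) ^ (1 - σ) with hr
  have hr0 : 0 < r := by positivity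
  have hr1 : r < 1 := Real.rpow_lt_one_of_one_lt_of_neg (by norm_num) (by linarith)
  -- The block `X 2⁻ʲ⁻¹ < y ≤ X 2⁻ʲ` has at most `2 B 2ʲ / X` members, each contributing at most `(X
  -- 2⁻ʲ) ^ σ`.
  have hfib : ∀ j ∈ s.image k, ∑ q ∈ s with k q = j, y q ^ σ ≤ 2 * B * X ^ (σ - 1) * r ^ j := by
    intro j _
    have hc : (((s.filter fun q ↦ k q = j).card : ℕ) : ℝ) ≤ B / (X * (1 / 2) ^ (j + 1)) := by
      refine hcard _ (Finset.filter_subset _ _) _ (by positivity) ?_ ?_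
      · exact mul_le_of_le_one_right hX.le (pow_le_one₀ (by norm_num) (by norm_num))
      · intro q hq
        obtain ⟨hqs, rfl⟩ := Finset.mem_filter.1 hq
        have := hk1 q hqs
        rw [lt_div_iff₀ hX] at this
        linarith
    have hterm : ∀ q ∈ s.filter (fun q ↦ k q = j), y q ^ σ ≤ (X * (1 / 2) ^ j) ^ σ := by
      intro q hq
      obtain ⟨hqs, rfl⟩ := Finset.mem_filter.1 hq
      have := hk2 q hqs
      rw [div_le_iff₀ hX] at this
      exact Real.rpow_le_rpow (hy0 q hqs).le (by linarith) (by linarith)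
    refine (Finset.sum_le_card_nsmul _ _ _ hterm).trans ?_
    rw [nsmul_eq_mul]
    refine (mul_le_mul_of_nonneg_right hc (by positivity)).trans (le_of_eq ?_)
    have e1 : (X * (1 / 2 : ℝ) ^ j) ^ σ = X * X ^ (σ - 1) * ((1 / 2 : ℝ) ^ j * r ^ j) := by
      rw [Real.mul_rpow hX.le (by positivity), Real.rpow_sub_one hX.ne', mul_div_cancel₀ _ hX.ne',
        ← mul_pow, ← Real.rpow_natCast, ← Real.rpow_mul (by norm_num), mul_comm (j : ℝ),
        Real.rpow_mul (by norm_num), Real.rpow_natCast, hr, Real.rpow_sub (by norm_num),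
        Real.rpow_one, Real.div_rpow (by norm_num) (by norm_num), Real.one_rpow]
      congr 2
      field_simp
    rw [e1]
    field_simp
    ring
  rw [← Finset.sum_fiberwise_of_maps_to (t := s.image k) (fun q hq ↦ Finset.mem_image_of_mem k hq)]
  refine (Finset.sum_le_sum hfib).trans ?_
  rw [← Finset.mul_sum]
  have hgeo : ∑ j ∈ s.image k, r ^ j ≤ (1 - r)⁻¹ := by
    rw [← tsum_geometric_of_lt_one hr0.le hr1]
    exact (summable_geometric_of_lt_one hr0.le hr1).sum_le_tsum _ (fun _ _ ↦ by positivity)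
  calc _ ≤ 2 * B * X ^ (σ - 1) * (1 - r)⁻¹ := by gcongr
    _ = _ := by ring

/-! ### Heights of translates and the Eisenstein series without modular symbols -/

namespace CuspSystem

variable {Γ : Subgroup SL(2, ℝ)} {ι : Type*}

/-- The height `Im (σ_𝔞⁻¹ γ z)`. -/
noncomputable def translateIm (C : CuspSystem Γ ι) (𝔞 : ι) (γ : Γ) (z : ℍ) : ℝ :=
  ((C.scaling 𝔞)⁻¹ • ((γ : SL(2, ℝ)) • z) : ℍ).im

lemma translateIm_pos (C : CuspSystem Γ ι) (𝔞 : ι) (γ : Γ) (z : ℍ) :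
    0 < C.translateIm 𝔞 γ z := UpperHalfPlane.im_pos _

lemma mem_stab_iff (C : CuspSystem Γ ι) (𝔞 : ι) (τ : Γ) :
    τ ∈ C.stab 𝔞 ↔ boundaryAct τ (C.cusp 𝔞) = C.cusp 𝔞 := Iff.rfl

lemma mem_stab_iff_lowerLeft (C : CuspSystem Γ ι) (𝔞 : ι) (τ : Γ) :
    τ ∈ C.stab 𝔞 ↔ ((C.scaling 𝔞)⁻¹ * τ * C.scaling 𝔞) 1 0 = 0 := by
  rw [mem_stab_iff, cusp, ← boundaryAct_mul, boundaryAct_infty_eq_iff, mul_assoc]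

lemma translateIm_stab_mul (C : CuspSystem Γ ι) (𝔞 : ι) {τ : Γ} (hτ : τ ∈ C.stab 𝔞) (γ : Γ)
    (z : ℍ) : C.translateIm 𝔞 (τ * γ) z = C.translateIm 𝔞 γ z := by
  obtain ⟨n, hn⟩ := (C.isScalingMatrix 𝔞).eq_translation τ τ.2 hτ
  set w : ℍ := (C.scaling 𝔞)⁻¹ • ((γ : SL(2, ℝ)) • z) with hw
  have e : (C.scaling 𝔞)⁻¹ • (((τ * γ : Γ) : SL(2, ℝ)) • z) =
      ((C.scaling 𝔞)⁻¹ * τ * C.scaling 𝔞) • w := by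
    rw [hw]
    simp only [Subgroup.coe_mul, ← mul_smul]
    congr 1
    group
  rw [translateIm, translateIm, e, ← hw, im_smul_eq_div_normSq_lowerRow]
  rcases hn with hn | hn
  · simp [hn, translation]
  · rw [hn, neg_translation_val]
    simp

lemma coset_ne_iff (C : CuspSystem Γ ι) (𝔞 : ι) {q q' : CuspCoset C 𝔞} (h : q ≠ q') :
    q'.out * (q.out)⁻¹ ∉ C.stab 𝔞 := by
  intro hmem
  apply h
  rw [← Quotient.out_eq q, ← Quotient.out_eq q']
  exact Quotient.sound (QuotientGroup.rightRel_apply.2 hmem)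

/-- Let `h q` be `σ_𝔞⁻¹ γ` times a matrix taking `i` to `z`; the height is the inverse square length
of its lower row. The determinant of two such rows is the lower left entry of `h q (h q')⁻¹`, from
which `z` cancels, so Shimizu's lemma applies. -/
lemma card_le_of_le_translateIm (hd : DiscreteTopology Γ) (C : CuspSystem Γ ι) (𝔞 : ι) (z : ℍ)
    (s : Finset (CuspCoset C 𝔞)) {t : ℝ} (ht : 0 < t)
    (hs : ∀ q ∈ s, t ≤ C.translateIm 𝔞 q.out z) : (s.card : ℝ) ≤ 8 / t + 4 := by
  set h : CuspCoset C 𝔞 → SL(2, ℝ) :=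
    fun q ↦ (C.scaling 𝔞)⁻¹ * ((q.out : Γ) : SL(2, ℝ)) * z.toSL2R with hh
  have him : ∀ q, C.translateIm 𝔞 q.out z = 1 / ((h q) 1 0 ^ 2 + (h q) 1 1 ^ 2) := by
    intro q
    rw [← im_smul_I, hh]
    simp only [mul_smul, toSL2R_smul_I]
    rfl
  have hpos : ∀ q, 0 < (h q) 1 0 ^ 2 + (h q) 1 1 ^ 2 := by
    intro q
    have := C.translateIm_pos 𝔞 q.out z
    rw [him] at this
    exact one_div_pos.1 this
  have := card_le_of_wedge s (fun q ↦ (h q) 1 0) (fun q ↦ (h q) 1 1) (T := 1 / t) (by positivity)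
    (fun q _ ↦ hpos q) ?_ ?_
  · calc _ ≤ _ := this
      _ = _ := by ring
  · intro q hq
    have := hs q hq
    rw [him] at this
    rwa [le_div_iff₀ ht, mul_comm, ← le_div_iff₀ (hpos q)]
  · intro q hq q' hq' hne
    rw [← sl_mul_inv_lowerLeft]
    have e : h q * (h q')⁻¹ =
        (C.scaling 𝔞)⁻¹ * ((q.out * (q'.out)⁻¹ : Γ) : SL(2, ℝ)) * C.scaling 𝔞 := by
      simp only [hh, Subgroup.coe_mul, Subgroup.coe_inv]
      group
    rw [e]
    refine (lowerLeft_eq_zero_or_half_le hd (C.isScalingMatrix 𝔞).translation_two_mem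
      (q.out * (q'.out)⁻¹ : Γ).2).resolve_left fun h0 ↦ ?_
    exact C.coset_ne_iff 𝔞 (Ne.symm hne) ((C.mem_stab_iff_lowerLeft 𝔞 _).2 h0)

/-- The Eisenstein series `∑ Im (σ_𝔞⁻¹ γ z) ^ σ` converges for `σ > 1`. -/
theorem summable_translateIm_rpow (hd : DiscreteTopology Γ) (C : CuspSystem Γ ι) (𝔞 : ι) (z : ℍ)
    {σ : ℝ} (hσ : 1 < σ) :
    Summable fun q : CuspCoset C 𝔞 ↦ C.translateIm 𝔞 q.out z ^ σ := by
  have hfin : {q : CuspCoset C 𝔞 | 1 ≤ C.translateIm 𝔞 q.out z}.Finite := by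
    by_contra hinf
    -- One more than the bound `8 / t + 4` at `t = 1`.
    obtain ⟨s, hs, hcard⟩ := Set.Infinite.exists_subset_card_eq hinf 13
    have := C.card_le_of_le_translateIm hd 𝔞 z s one_pos fun q hq ↦ hs hq
    rw [hcard] at this
    norm_num at this
  obtain ⟨X₀, hX₀⟩ := (hfin.image fun q ↦ C.translateIm 𝔞 q.out z).bddAbove
  set X := max 1 X₀ with hX
  have hX1 : 1 ≤ X := le_max_left _ _
  have hle : ∀ q : CuspCoset C 𝔞, C.translateIm 𝔞 q.out z ≤ X := by
    intro q
    rcases le_total 1 (C.translateIm 𝔞 q.out z) with h | h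
    · exact (hX₀ ⟨q, h, rfl⟩).trans (le_max_right _ _)
    · exact h.trans hX1
  refine summable_of_sum_le (fun q ↦ Real.rpow_nonneg (C.translateIm_pos 𝔞 _ z).le _)
    (c := (8 + 4 * X) * (2 * (1 - (2 : ℝ) ^ (1 - σ))⁻¹) * X ^ (σ - 1)) fun s ↦ ?_
  -- For `t ≤ X`, the count `8 / t + 4` is at most `(8 + 4 X) / t`.
  refine sum_rpow_le_of_card_le (by linarith) hσ s _ (fun q _ ↦ C.translateIm_pos 𝔞 _ z)
    (fun q _ ↦ hle q) fun s' _ t ht htX h ↦ ?_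
  refine (C.card_le_of_le_translateIm hd 𝔞 z s' ht h).trans ?_
  rw [add_div]
  gcongr
  rw [le_div_iff₀ ht]
  linarith

lemma finite_setOf_le_translateIm (hd : DiscreteTopology Γ) (C : CuspSystem Γ ι) (𝔞 : ι) (z : ℍ)
    {t : ℝ} (ht : 0 < t) : {q : CuspCoset C 𝔞 | t ≤ C.translateIm 𝔞 q.out z}.Finite := by
  by_contra hinf
  obtain ⟨s, hs, hcard⟩ := Set.Infinite.exists_subset_card_eq hinf (⌊8 / t + 4⌋₊ + 1)
  have := C.card_le_of_le_translateIm hd 𝔞 z s ht fun q hq ↦ hs hq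
  rw [hcard] at this
  push_cast at this
  linarith [Nat.lt_floor_add_one (8 / t + 4)]

/-- For two different cusps `h = σ_𝔞⁻¹ γ σ_𝔟` is not conjugated from `Γ` by one scaling matrix, but
`h T² h⁻¹` is. Its lower left entry is `-2 c ^ 2`, so Shimizu's lemma gives `2 c ^ 2 ≥ 1 / 2`. -/
lemma lowerLeft_eq_zero_or_quarter_le (hd : DiscreteTopology Γ) (C : CuspSystem Γ ι) (𝔞 𝔟 : ι)
    (γ : Γ) : ((C.scaling 𝔞)⁻¹ * γ * C.scaling 𝔟) 1 0 = 0 ∨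
      1 / 4 ≤ (((C.scaling 𝔞)⁻¹ * γ * C.scaling 𝔟) 1 0) ^ 2 := by
  set h := (C.scaling 𝔞)⁻¹ * γ * C.scaling 𝔟 with hh
  have hmem := Γ.mul_mem (Γ.mul_mem γ.2 (C.isScalingMatrix 𝔟).translation_two_mem) (Γ.inv_mem γ.2)
  have e : (C.scaling 𝔞)⁻¹ * ((γ : SL(2, ℝ)) * (C.scaling 𝔟 * translation 2 * (C.scaling 𝔟)⁻¹) *
      (γ : SL(2, ℝ))⁻¹) * C.scaling 𝔞 = h * translation 2 * h⁻¹ := by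
    rw [hh]; group
  have key := lowerLeft_eq_zero_or_half_le hd (C.isScalingMatrix 𝔞).translation_two_mem hmem
  rw [e, conj_translation_two] at key
  simp only [of_apply, cons_val', cons_val_zero, cons_val_fin_one, cons_val_one] at key
  rcases key with key | key
  · left
    simpa using key
  · right
    rw [abs_mul, abs_neg, abs_two, abs_of_nonneg (sq_nonneg _)] at key
    linarith

/-- A zero entry says that `γ` carries the cusp `𝔟` to `𝔞`, and distinct labels are inequivalent. -/
lemma eq_and_mem_stab_of_lowerLeft_eq_zero (C : CuspSystem Γ ι) {𝔞 𝔟 : ι} {γ : Γ}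
    (h : ((C.scaling 𝔞)⁻¹ * γ * C.scaling 𝔟) 1 0 = 0) : 𝔟 = 𝔞 ∧ γ ∈ C.stab 𝔞 := by
  rw [mul_assoc, ← boundaryAct_infty_eq_iff, boundaryAct_mul] at h
  have := C.inequivalent 𝔟 𝔞 γ γ.2 h
  subst this
  exact ⟨rfl, h⟩

lemma translateIm_le_of_lowerLeft_ne_zero (hd : DiscreteTopology Γ) (C : CuspSystem Γ ι) (𝔞 𝔟 : ι)
    (γ : Γ) (hγ : ((C.scaling 𝔞)⁻¹ * γ * C.scaling 𝔟) 1 0 ≠ 0) (w : ℍ) :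
    C.translateIm 𝔞 γ (C.scaling 𝔟 • w) ≤ 4 / w.im := by
  have hc := (C.lowerLeft_eq_zero_or_quarter_le hd 𝔞 𝔟 γ).resolve_left hγ
  rw [translateIm, ← mul_smul, ← mul_smul, im_smul_eq_div_normSq_lowerRow]
  set h := (C.scaling 𝔞)⁻¹ * γ * C.scaling 𝔟
  have hw := w.im_pos
  have hN : (h 1 0 * w.im) ^ 2 ≤ Complex.normSq ((h 1 0 : ℂ) * w + h 1 1) := by
    rw [Complex.normSq_apply]
    simp
    nlinarith [mul_self_nonneg (h 1 0 * w.re + h 1 1)]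
  have h4 : w.im ^ 2 / 4 ≤ Complex.normSq ((h 1 0 : ℂ) * w + h 1 1) := by
    refine le_trans ?_ hN
    rw [mul_pow]
    nlinarith [sq_nonneg w.im]
  calc w.im / Complex.normSq ((h 1 0 : ℂ) * w + h 1 1) ≤ w.im / (w.im ^ 2 / 4) := by gcongr
    _ = 4 / w.im := by field_simp

/-- The Eisenstein series at a point high up in a cuspidal zone, without its leading term. -/
lemma sum_translateIm_rpow_le (hd : DiscreteTopology Γ) (C : CuspSystem Γ ι) (𝔞 𝔟 : ι)
    {σ : ℝ} (hσ : 1 < σ) (w : ℍ) (hw : 1 ≤ w.im) (s : Finset (CuspCoset C 𝔞))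
    (hs : ∀ q ∈ s, ((C.scaling 𝔞)⁻¹ * (q.out : Γ) * C.scaling 𝔟) 1 0 ≠ 0) :
    ∑ q ∈ s, C.translateIm 𝔞 q.out (C.scaling 𝔟 • w) ^ σ ≤
      24 * (2 * (1 - (2 : ℝ) ^ (1 - σ))⁻¹) * (4 / w.im) ^ (σ - 1) := by
  refine sum_rpow_le_of_card_le (by positivity) hσ s _ (fun q _ ↦ C.translateIm_pos 𝔞 _ _)
    (fun q hq ↦ C.translateIm_le_of_lowerLeft_ne_zero hd 𝔞 𝔟 _ (hs q hq) w)
    fun s' _ t ht htX h ↦ ?_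
  refine (C.card_le_of_le_translateIm hd 𝔞 _ s' ht h).trans ?_
  -- Since `t ≤ 4`, the summand 4 of the count is absorbed as `16 / t`.
  have : t ≤ 4 := htX.trans (div_le_self (by norm_num) hw)
  rw [show (24 : ℝ) / t = 8 / t + 16 / t by ring]
  gcongr
  rw [le_div_iff₀ ht]
  linarith

lemma le_height [Finite ι] (C : CuspSystem Γ ι) (𝔞 : ι) (z : ℍ) :
    ((C.scaling 𝔞)⁻¹ • z).im ≤ C.height z :=
  le_ciSup (f := fun 𝔞 ↦ ((C.scaling 𝔞)⁻¹ • z).im) (Set.finite_range _).bddAbove 𝔞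

lemma height_pos [Finite ι] (C : CuspSystem Γ ι) (𝔞 : ι) (z : ℍ) : 0 < C.height z :=
  (UpperHalfPlane.im_pos _).trans_le (C.le_height 𝔞 z)

/-- Seen from any other cusp the height is at most `4 / Im w`, which is at most `Im w` from 2 on. -/
lemma height_eq_of_two_le [Finite ι] (hd : DiscreteTopology Γ) (C : CuspSystem Γ ι) (𝔟 : ι)
    (w : ℍ) (hw : 2 ≤ w.im) : C.height (C.scaling 𝔟 • w) = w.im := by
  have : Nonempty ι := ⟨𝔟⟩
  apply le_antisymm
  · refine ciSup_le fun 𝔞 ↦ ?_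
    by_cases h : ((C.scaling 𝔞)⁻¹ * (1 : Γ) * C.scaling 𝔟) 1 0 = 0
    · obtain ⟨rfl, -⟩ := C.eq_and_mem_stab_of_lowerLeft_eq_zero h
      rw [inv_smul_smul]
    · have := C.translateIm_le_of_lowerLeft_ne_zero hd 𝔞 𝔟 1 h w
      rw [translateIm, OneMemClass.coe_one, one_smul] at this
      refine this.trans ?_
      rw [div_le_iff₀ w.im_pos]
      nlinarith
  · have := C.le_height 𝔟 (C.scaling 𝔟 • w)
    rwa [inv_smul_smul] at this

/-- The action is isometric, so the factor is the same for all `γ`; one majorant then serves a whole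
compact set. -/
lemma translateIm_le_mul_exp_dist (C : CuspSystem Γ ι) (𝔞 : ι) (γ : Γ) (z w : ℍ) :
    C.translateIm 𝔞 γ z ≤ C.translateIm 𝔞 γ w * Real.exp (dist z w) := by
  have := UpperHalfPlane.im_le_im_mul_exp_dist ((C.scaling 𝔞)⁻¹ • ((γ : SL(2, ℝ)) • z))
    ((C.scaling 𝔞)⁻¹ • ((γ : SL(2, ℝ)) • w))
  rwa [dist_smul, dist_smul] at this

end CuspSystem

/-! ### The primitive of a holomorphic function on the upper half-plane -/

/-- The integral of `f(w) dw` along the straight segment from `i` to `z`. -/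
noncomputable def segmentPrimitive (f : ℍ → ℂ) (z : ℂ) : ℂ :=
  ∫ t in (0 : ℝ)..1, f (ofComplex ((I : ℂ) + t * (z - (I : ℂ)))) * (z - (I : ℂ))

lemma modularSymbol_eq_segmentPrimitive (f : ℍ → ℂ) (γ : SL(2, ℝ)) :
    modularSymbol f γ = segmentPrimitive f (γ • I : ℍ) := rfl

lemma segmentPrimitive_I (f : ℍ → ℂ) : segmentPrimitive f (I : ℍ) = 0 := by
  simp [segmentPrimitive]

lemma intervalIntegral_segment_eq_sub {U : Set ℂ} (hU : Convex ℝ U) {F G : ℂ → ℂ}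
    (hF : ContinuousOn F U) (hG : ∀ w ∈ U, HasDerivAt G (F w) w) {a z : ℂ} (ha : a ∈ U)
    (hz : z ∈ U) : ∫ t in (0 : ℝ)..1, F (a + t * (z - a)) * (z - a) = G z - G a := by
  have hmem : ∀ t ∈ Set.uIcc (0 : ℝ) 1, a + t * (z - a) ∈ U := by
    intro t ht
    rw [Set.uIcc_of_le zero_le_one] at ht
    have := hU.add_smul_sub_mem ha hz ht
    simpa using this
  have hline : ∀ t : ℝ, HasDerivAt (fun t : ℝ ↦ a + t * (z - a)) (z - a) t := by
    intro t
    simpa using ((Complex.ofRealCLM.hasDerivAt (x := t)).mul_const (z - a)).const_add a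
  rw [intervalIntegral.integral_eq_sub_of_hasDerivAt (f := fun t : ℝ ↦ G (a + t * (z - a)))]
  · simp
  · intro t ht
    exact (hG _ (hmem t ht)).comp_of_eq t (hline t) rfl
  · refine ContinuousOn.intervalIntegrable ?_
    refine ContinuousOn.mul (hF.comp ?_ hmem) continuousOn_const
    exact fun t _ ↦ (hline t).continuousAt.continuousWithinAt

lemma hasDerivAt_segmentPrimitive {f : ℍ → ℂ} (hf : MDiff f) {z : ℂ} (hz : 0 < z.im) :
    HasDerivAt (segmentPrimitive f) (f (ofComplex z)) z := by
  have hF := UpperHalfPlane.mdifferentiable_iff.1 hf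
  -- The disc of centre `i R` and radius `R` is `|w| ^ 2 < 2 R Im w`, tangent to the real axis. This
  -- `R` is large enough for it to contain both `z` and `i`, and on a disc primitives exist.
  set R : ℝ := (Complex.normSq z + 1) / z.im + 1 with hR
  have hR1 : 1 ≤ R := by
    have : 0 ≤ (Complex.normSq z + 1) / z.im :=
      div_nonneg (by linarith [Complex.normSq_nonneg z]) hz.le
    linarith
  set c : ℂ := ⟨0, R⟩ with hc
  have hball : ∀ w : ℂ, w ∈ Metric.ball c R ↔ Complex.normSq w < 2 * R * w.im := by
    intro w
    rw [Metric.mem_ball, Complex.dist_eq, ← sq_lt_sq₀ (norm_nonneg _) (by linarith),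
      ← Complex.normSq_eq_norm_sq, Complex.normSq_apply, Complex.normSq_apply]
    simp only [hc, Complex.sub_re, Complex.sub_im]
    constructor <;> intro h <;> nlinarith
  have hsub : Metric.ball c R ⊆ {w | 0 < w.im} := by
    intro w hw
    have h1 := (hball w).1 hw
    have h2 := Complex.normSq_nonneg w
    by_contra hneg
    simp only [Set.mem_ofPred_eq, not_lt] at hneg
    nlinarith
  have hzR : z ∈ Metric.ball c R := by
    rw [hball]
    have : (Complex.normSq z + 1) / z.im * z.im = Complex.normSq z + 1 := by field_simp
    nlinarith [Complex.normSq_nonneg z]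
  have hIR : ((I : ℍ) : ℂ) ∈ Metric.ball c R := by
    rw [hball]
    simp
    linarith
  have hFb := hF.mono hsub
  obtain ⟨G, hG⟩ := hFb.isExactOn_ball
  have hEq : ∀ w ∈ Metric.ball c R, segmentPrimitive f w = G w - G (I : ℍ) := fun w hw ↦
    intervalIntegral_segment_eq_sub (convex_ball c R) hFb.continuousOn hG hIR hw
  refine ((hG z hzR).sub_const (G (I : ℍ))).congr_of_eventuallyEq ?_
  filter_upwards [Metric.isOpen_ball.mem_nhds hzR] with w hw using hEq w hw

lemma slash_two_apply (f : ℍ → ℂ) (g : SL(2, ℝ)) (z : ℍ) :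
    (f ∣[(2 : ℤ)] (Matrix.SpecialLinearGroup.toGL g)) z =
      f (g • z) / (denom (Matrix.SpecialLinearGroup.toGL g) z) ^ 2 := by
  rw [ModularForm.slash_apply]
  simp [σ, _root_.zpow_neg, div_eq_mul_inv]
  rfl

/-- In weight 2 the slash action is the pullback of the form `f(w) dw`. -/
lemma hasDerivAt_segmentPrimitive_smul {f : ℍ → ℂ} (hf : MDiff f) (g : SL(2, ℝ)) {z : ℂ}
    (hz : 0 < z.im) :
    HasDerivAt (fun w : ℂ ↦ segmentPrimitive f (g • ofComplex w : ℍ))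
      ((f ∣[(2 : ℤ)] (Matrix.SpecialLinearGroup.toGL g)) (ofComplex z)) z := by
  lift z to ℍ using hz
  have h1 := (hasStrictDerivAt_smul (g := Matrix.SpecialLinearGroup.toGL g)
    (by simp) z).hasDerivAt
  have h2 := hasDerivAt_segmentPrimitive hf (z := (g • z : ℍ)) (UpperHalfPlane.im_pos _)
  rw [ofComplex_apply] at h2 ⊢
  have h3 := h2.comp_of_eq (z : ℂ) h1 (by rw [ofComplex_apply]; rfl)
  rw [slash_two_apply]
  refine h3.congr_deriv ?_
  simp [div_eq_mul_inv]

lemma eq_of_hasDerivAt_zero_of_im_pos {D : ℂ → ℂ} (hD : ∀ z : ℂ, 0 < z.im → HasDerivAt D 0 z)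
    {z w : ℂ} (hz : 0 < z.im) (hw : 0 < w.im) : D z = D w := by
  refine isOpen_upperHalfPlaneSet.is_const_of_deriv_eq_zero ?_ ?_ ?_ hz hw
  · exact (convex_halfSpace_im_gt 0).isPreconnected
  · exact fun z hz ↦ (hD z hz).differentiableAt.differentiableWithinAt
  · exact fun z hz ↦ (hD z hz).deriv

/-- The left side has derivative `f ∣ γ - f = 0`, so it is constant and may be evaluated at `i`.
This is the independence of the base point. -/
lemma segmentPrimitive_smul_sub {f : ℍ → ℂ} (hf : MDiff f) {γ : SL(2, ℝ)}
    (hγ : f ∣[(2 : ℤ)] (Matrix.SpecialLinearGroup.toGL γ) = f) (z : ℍ) :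
    segmentPrimitive f (γ • z : ℍ) - segmentPrimitive f z = modularSymbol f γ := by
  have := eq_of_hasDerivAt_zero_of_im_pos
    (D := fun w ↦ segmentPrimitive f (γ • ofComplex w : ℍ) - segmentPrimitive f w) ?_
    (z := z) (w := (I : ℍ)) z.im_pos I.im_pos
  · simpa only [ofComplex_apply, segmentPrimitive_I, sub_zero,
      modularSymbol_eq_segmentPrimitive] using this
  · intro w hw
    have h1 := hasDerivAt_segmentPrimitive_smul hf γ hw
    rw [hγ] at h1
    exact (h1.sub (hasDerivAt_segmentPrimitive hf hw)).congr_deriv (sub_self _)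

lemma modularSymbol_mul {f : ℍ → ℂ} (hf : MDiff f) {γ : SL(2, ℝ)}
    (hγ : f ∣[(2 : ℤ)] (Matrix.SpecialLinearGroup.toGL γ) = f) (δ : SL(2, ℝ)) :
    modularSymbol f (γ * δ) = modularSymbol f γ + modularSymbol f δ := by
  rw [modularSymbol_eq_segmentPrimitive, mul_smul, ← segmentPrimitive_smul_sub hf hγ (δ • I),
    modularSymbol_eq_segmentPrimitive f δ]
  ring

/-! ### Growth of a primitive near a cusp -/

section CuspGrowth

variable {Φ φ : ℂ → ℂ} {C : ℝ}

lemma norm_sub_le_horizontal (hΦ : ∀ z : ℂ, 0 < z.im → HasDerivAt Φ (φ z) z)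
    (hφ : ∀ z : ℂ, 0 < z.im → ‖φ z‖ ≤ C / z.im) {y : ℝ} (hy : 0 < y) (x x' : ℝ) :
    ‖Φ ⟨x', y⟩ - Φ ⟨x, y⟩‖ ≤ C / y * |x' - x| := by
  have hd : ∀ t : ℝ, HasDerivAt (fun t : ℝ ↦ Φ ⟨t, y⟩) (φ ⟨t, y⟩) t := by
    intro t
    have h1 : HasDerivAt (fun t : ℝ ↦ (⟨t, y⟩ : ℂ)) 1 t := by
      have : (fun t : ℝ ↦ (⟨t, y⟩ : ℂ)) = fun t : ℝ ↦ (t : ℂ) + (⟨0, y⟩ : ℂ) := by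
        funext t; apply Complex.ext <;> simp
      rw [this]
      simpa using (Complex.ofRealCLM.hasDerivAt (x := t)).add_const (⟨0, y⟩ : ℂ)
    exact ((hΦ ⟨t, y⟩ hy).comp_of_eq t h1 rfl).congr_deriv (mul_one _)
  exact convex_univ.norm_image_sub_le_of_norm_hasDerivWithin_le
    (fun t _ ↦ (hd t).hasDerivWithinAt) (fun t _ ↦ hφ ⟨t, y⟩ hy) (Set.mem_univ x) (Set.mem_univ x')

/-- With `y = exp t` the bound `C / y` becomes a constant bound for the derivative. -/
lemma norm_sub_le_vertical_log (hΦ : ∀ z : ℂ, 0 < z.im → HasDerivAt Φ (φ z) z)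
    (hφ : ∀ z : ℂ, 0 < z.im → ‖φ z‖ ≤ C / z.im) {y : ℝ} (hy : 0 < y) (x : ℝ) :
    ‖Φ ⟨x, y⟩ - Φ ⟨x, 1⟩‖ ≤ C * |Real.log y| := by
  have hd : ∀ t : ℝ, HasDerivAt (fun t : ℝ ↦ Φ ⟨x, Real.exp t⟩)
      (φ ⟨x, Real.exp t⟩ * (Real.exp t * Complex.I)) t := by
    intro t
    have h1 : HasDerivAt (fun t : ℝ ↦ (⟨x, Real.exp t⟩ : ℂ)) (Real.exp t * Complex.I) t := by
      have : (fun t : ℝ ↦ (⟨x, Real.exp t⟩ : ℂ)) =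
          fun t : ℝ ↦ (x : ℂ) + ((Real.exp t : ℝ) : ℂ) * Complex.I := by
        funext t; apply Complex.ext <;> simp [-Complex.ofReal_exp]
      rw [this]
      exact ((Real.hasDerivAt_exp t).ofReal_comp.mul_const Complex.I).const_add _
    exact (hΦ ⟨x, Real.exp t⟩ (Real.exp_pos t)).comp_of_eq t h1 rfl
  have := convex_univ.norm_image_sub_le_of_norm_hasDerivWithin_le (C := C)
    (fun t _ ↦ (hd t).hasDerivWithinAt) (fun t _ ↦ ?_) (Set.mem_univ 0) (Set.mem_univ (Real.log y))
  · simpa [Real.exp_log hy] using this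
  · have h1 := hφ ⟨x, Real.exp t⟩ (Real.exp_pos t)
    rw [norm_mul, norm_mul, Complex.norm_I, mul_one, Complex.norm_real, Real.norm_eq_abs,
      abs_of_pos (Real.exp_pos t)]
    rwa [le_div_iff₀ (Real.exp_pos t)] at h1

/-- With `y = 1 / u` the bound `C / y ^ 2` becomes a constant bound on `(0, 1]`. -/
lemma norm_sub_le_vertical (hΦ : ∀ z : ℂ, 0 < z.im → HasDerivAt Φ (φ z) z)
    (hφ : ∀ z : ℂ, 1 ≤ z.im → ‖φ z‖ ≤ C / z.im ^ 2) (hC : 0 ≤ C) {y y' : ℝ} (hy : 1 ≤ y)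
    (hy' : 1 ≤ y') (x : ℝ) : ‖Φ ⟨x, y'⟩ - Φ ⟨x, y⟩‖ ≤ C := by
  have hd : ∀ u ∈ Set.Ioc (0 : ℝ) 1, HasDerivAt (fun u : ℝ ↦ Φ ⟨x, u⁻¹⟩)
      (φ ⟨x, u⁻¹⟩ * (((-(u ^ 2)⁻¹ : ℝ) : ℂ) * Complex.I)) u := by
    intro u hu
    have h1 : HasDerivAt (fun u : ℝ ↦ (⟨x, u⁻¹⟩ : ℂ)) (((-(u ^ 2)⁻¹ : ℝ) : ℂ) * Complex.I) u := by
      have : (fun u : ℝ ↦ (⟨x, u⁻¹⟩ : ℂ)) =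
          fun u : ℝ ↦ (x : ℂ) + ((u⁻¹ : ℝ) : ℂ) * Complex.I := by
        funext t; apply Complex.ext <;> simp [-Complex.ofReal_inv]
      rw [this]
      exact ((hasDerivAt_inv hu.1.ne').ofReal_comp.mul_const Complex.I).const_add _
    exact (hΦ ⟨x, u⁻¹⟩ (inv_pos.2 hu.1)).comp_of_eq u h1 rfl
  have hb : ∀ u ∈ Set.Ioc (0 : ℝ) 1,
      ‖φ ⟨x, u⁻¹⟩ * (((-(u ^ 2)⁻¹ : ℝ) : ℂ) * Complex.I)‖ ≤ C := by
    intro u hu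
    have h1 := hφ ⟨x, u⁻¹⟩ (one_le_inv_iff₀.2 hu)
    have hu0 := hu.1
    rw [norm_mul, norm_mul, Complex.norm_I, mul_one, Complex.norm_real, Real.norm_eq_abs, abs_neg,
      abs_of_pos (by positivity)]
    simp only [inv_pow, div_inv_eq_mul] at h1
    rwa [← div_eq_mul_inv, div_le_iff₀ (by positivity)]
  have hm : ∀ {y : ℝ}, 1 ≤ y → y⁻¹ ∈ Set.Ioc (0 : ℝ) 1 := fun h ↦
    ⟨by positivity, inv_le_one_of_one_le₀ h⟩
  have := (convex_Ioc (0 : ℝ) 1).norm_image_sub_le_of_norm_hasDerivWithin_le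
    (fun u hu ↦ (hd u hu).hasDerivWithinAt) hb (hm hy) (hm hy')
  simp only [inv_inv] at this
  refine this.trans (mul_le_of_le_one_right hC ?_)
  rw [Real.norm_eq_abs, abs_le]
  have := hm hy
  have := hm hy'
  constructor <;> linarith [(hm hy).1, (hm hy).2, (hm hy').1, (hm hy').2]

lemma eq_zero_of_translation_sub_eq (hΦ : ∀ z : ℂ, 0 < z.im → HasDerivAt Φ (φ z) z)
    (hφ : ∀ z : ℂ, 0 < z.im → ‖φ z‖ ≤ C / z.im) {h : ℝ} {c : ℂ}
    (hc : ∀ y : ℝ, 0 < y → Φ ⟨h, y⟩ - Φ ⟨0, y⟩ = c) : c = 0 := by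
  have hlim : Tendsto (fun y : ℝ ↦ C / y * |h - 0|) atTop (𝓝 0) := by
    simpa using (tendsto_const_nhds.div_atTop tendsto_id : Tendsto (fun y : ℝ ↦ C / y) atTop
      (𝓝 0)).mul_const |h - 0|
  refine norm_le_zero_iff.1 (ge_of_tendsto hlim ?_)
  filter_upwards [eventually_gt_atTop 0] with y hy
  rw [← hc y hy]
  exact norm_sub_le_horizontal hΦ hφ hy 0 h

/-- Go up to height `Y`, across, and down: the horizontal part costs `C |x| / Y`, which vanishes as
`Y → ∞`, so the bound is uniform in `x`. -/
lemma norm_sub_le_of_one_le_im (hΦ : ∀ z : ℂ, 0 < z.im → HasDerivAt Φ (φ z) z)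
    (hφ : ∀ z : ℂ, 0 < z.im → ‖φ z‖ ≤ C / z.im)
    (hφ' : ∀ z : ℂ, 1 ≤ z.im → ‖φ z‖ ≤ C / z.im ^ 2) (hC : 0 ≤ C) {x y : ℝ} (hy : 1 ≤ y) :
    ‖Φ ⟨x, y⟩ - Φ ⟨0, 1⟩‖ ≤ 2 * C := by
  have hlim : Tendsto (fun Y : ℝ ↦ C + C / Y * |x - 0| + C) atTop (𝓝 (2 * C)) := by
    have := ((tendsto_const_nhds.div_atTop tendsto_id : Tendsto (fun y : ℝ ↦ C / y) atTop
      (𝓝 0)).mul_const |x - 0|).const_add C |>.add_const C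
    convert this using 2
    ring
  refine ge_of_tendsto hlim ?_
  filter_upwards [eventually_ge_atTop 1] with Y hY
  have e : Φ ⟨x, y⟩ - Φ ⟨0, 1⟩ = (Φ ⟨x, y⟩ - Φ ⟨x, Y⟩) + (Φ ⟨x, Y⟩ - Φ ⟨0, Y⟩) +
      (Φ ⟨0, Y⟩ - Φ ⟨0, 1⟩) := by ring
  rw [e]
  refine (norm_add₃_le).trans ?_
  gcongr
  · exact norm_sub_le_vertical hΦ hφ' hC hY hy x
  · exact norm_sub_le_horizontal hΦ hφ (by linarith) 0 x
  · exact norm_sub_le_vertical hΦ hφ' hC le_rfl hY 0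

/-- A primitive of a function that is `O(1 / y)`, and `O(1 / y²)` near `∞`, is
`O(max 1 y^{-ε})`. -/
lemma exists_norm_le_max_one_rpow (hΦ : ∀ z : ℂ, 0 < z.im → HasDerivAt Φ (φ z) z)
    (hφ : ∀ z : ℂ, 0 < z.im → ‖φ z‖ ≤ C / z.im)
    (hφ' : ∀ z : ℂ, 1 ≤ z.im → ‖φ z‖ ≤ C / z.im ^ 2) (hC : 0 ≤ C) {ε : ℝ} (hε : 0 < ε) :
    ∃ M, 0 ≤ M ∧ ∀ z : ℂ, 0 < z.im → ‖Φ z‖ ≤ M * max 1 (z.im ^ (-ε)) := by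
  set M₀ := ‖Φ ⟨0, 1⟩‖ + 2 * C with hM₀
  have hM₀0 : 0 ≤ M₀ := by positivity
  have hM : ∀ x y : ℝ, 1 ≤ y → ‖Φ ⟨x, y⟩‖ ≤ M₀ := by
    intro x y hy
    have h1 := norm_sub_le_of_one_le_im hΦ hφ hφ' hC (x := x) hy
    have h2 := norm_sub_norm_le (Φ ⟨x, y⟩) (Φ ⟨0, 1⟩)
    linarith
  refine ⟨M₀ + C / ε, by positivity, ?_⟩
  rintro ⟨x, y⟩ (hy : 0 < y)
  show ‖Φ ⟨x, y⟩‖ ≤ (M₀ + C / ε) * max 1 (y ^ (-ε))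
  have hCε : 0 ≤ C / ε := by positivity
  rcases le_total 1 y with h | h
  · calc ‖Φ ⟨x, y⟩‖ ≤ M₀ * 1 := by simpa using hM x y h
      _ ≤ (M₀ + C / ε) * max 1 (y ^ (-ε)) := by
        gcongr
        · linarith
        · exact le_max_left _ _
  · have h1 := norm_sub_le_vertical_log hΦ hφ hy x
    have h2 := norm_sub_norm_le (Φ ⟨x, y⟩) (Φ ⟨x, 1⟩)
    have h3 : |Real.log y| ≤ y ^ (-ε) / ε := by
      rw [abs_of_nonpos (Real.log_nonpos hy.le h), ← Real.log_inv, Real.rpow_neg hy.le,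
        ← Real.inv_rpow hy.le]
      exact Real.log_le_rpow_div (inv_nonneg.2 hy.le) hε
    have h4 := le_max_left 1 (y ^ (-ε))
    have h5 := le_max_right 1 (y ^ (-ε))
    calc ‖Φ ⟨x, y⟩‖ ≤ M₀ + C * |Real.log y| := by linarith [hM x 1 le_rfl]
      _ ≤ M₀ * max 1 (y ^ (-ε)) + C * (y ^ (-ε) / ε) := by
        gcongr
        exact le_mul_of_one_le_right hM₀0 h4
      _ = M₀ * max 1 (y ^ (-ε)) + C / ε * y ^ (-ε) := by ring
      _ ≤ M₀ * max 1 (y ^ (-ε)) + C / ε * max 1 (y ^ (-ε)) := by gcongr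
      _ = _ := by ring

end CuspGrowth

/-! ### Cusp forms of weight 2 and the size of their modular symbols -/

section CuspForm

variable {Γ : Subgroup SL(2, ℝ)}

lemma CuspForm.slash_toGL_eq (f : CuspForm (glImage Γ) 2) {γ : SL(2, ℝ)} (hγ : γ ∈ Γ) :
    (⇑f) ∣[(2 : ℤ)] (Matrix.SpecialLinearGroup.toGL γ) = ⇑f :=
  SlashInvariantForm.slash_action_eqn f _ (Subgroup.mem_map_of_mem _ hγ)

lemma toGL_translation_apply (x : ℝ) (i j : Fin 2) :
    (Matrix.SpecialLinearGroup.toGL (translation x)) i j = !![1, x; 0, 1] i j := rfl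

lemma IsScalingMatrix.isCusp {σ : SL(2, ℝ)} (hσ : IsScalingMatrix Γ σ) :
    IsCusp (boundaryAct σ OnePoint.infty) (glImage Γ) := by
  refine ⟨_, Subgroup.mem_map_of_mem _ hσ.translation_two_mem, ?_, ?_⟩
  · rw [map_mul, map_mul, map_inv, GeneralLinearGroup.isParabolic_conj_iff,
      GeneralLinearGroup.isParabolic_iff_of_upperTriangular] <;> simp [toGL_translation_apply]
  · rw [← boundaryAct, ← boundaryAct_mul, inv_mul_cancel_right, boundaryAct_mul]
    congr 1
    rw [boundaryAct_infty_eq_infty_iff]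
    simp [translation]

lemma translation_smul (x : ℝ) (z : ℍ) : translation x • z = x +ᵥ z := by
  ext
  rw [UpperHalfPlane.coe_specialLinearGroup_apply]
  simp [translation, add_comm]

lemma neg_translation_smul (x : ℝ) (z : ℍ) : -translation x • z = x +ᵥ z := by
  ext
  rw [UpperHalfPlane.coe_specialLinearGroup_apply, neg_translation_val]
  simp [add_comm]
  rw [div_neg, div_one]
  ring

lemma im_mul_norm_smul (f : ℍ → ℂ) (g : SL(2, ℝ)) (z : ℍ) :
    (g • z).im * ‖f (g • z)‖ =
      z.im * ‖(f ∣[(2 : ℤ)] (Matrix.SpecialLinearGroup.toGL g)) z‖ := by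
  rw [slash_two_apply, im_smul_eq_div_normSq_lowerRow, norm_div, norm_pow,
    Complex.normSq_eq_norm_sq]
  simp [denom]
  ring

lemma im_mul_norm_smul_of_mem (f : CuspForm (glImage Γ) 2) {γ : SL(2, ℝ)} (hγ : γ ∈ Γ) (z : ℍ) :
    (γ • z).im * ‖f (γ • z)‖ = z.im * ‖f z‖ := by
  rw [im_mul_norm_smul, f.slash_toGL_eq hγ]

/-- Exponential decay of a cusp form of weight 2 at a cusp, in a weak form. -/
lemma exists_norm_slash_le (f : CuspForm (glImage Γ) 2) {σ : SL(2, ℝ)}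
    (hσ : IsScalingMatrix Γ σ) : ∃ A C : ℝ, 1 ≤ A ∧ 0 ≤ C ∧ ∀ z : ℍ, A ≤ z.im →
      ‖((⇑f) ∣[(2 : ℤ)] (Matrix.SpecialLinearGroup.toGL σ)) z‖ ≤ C / z.im ^ 2 := by
  set φ := (⇑f) ∣[(2 : ℤ)] (Matrix.SpecialLinearGroup.toGL σ) with hφ
  have hzero : IsZeroAtImInfty φ := CuspFormClass.zero_at_cusps f hσ.isCusp _ rfl
  have hhol : MDiff φ := MDifferentiable.slash (CuspFormClass.holo f) 2 _
  have hT : φ ∣[(2 : ℤ)] (Matrix.SpecialLinearGroup.toGL (translation 2)) = φ := by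
    have h1 := f.slash_toGL_eq hσ.translation_two_mem
    have h2 : Matrix.SpecialLinearGroup.toGL σ * Matrix.SpecialLinearGroup.toGL (translation 2) =
        Matrix.SpecialLinearGroup.toGL (σ * translation 2 * σ⁻¹) *
          Matrix.SpecialLinearGroup.toGL σ := by
      rw [← map_mul, ← map_mul, inv_mul_cancel_right]
    rw [hφ, ← SlashAction.slash_mul, h2, SlashAction.slash_mul, h1]
  have hper : Function.Periodic (φ ∘ ofComplex) ((2 : ℝ) : ℂ) := by
    intro w
    rcases lt_or_ge 0 w.im with hw | hw
    · have h1 := congrFun hT (ofComplex w)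
      rw [slash_two_apply, translation_smul] at h1
      have h2 : ofComplex (w + (2 : ℝ)) = (2 : ℝ) +ᵥ ofComplex w := by
        ext
        rw [UpperHalfPlane.coe_vadd, ofComplex_apply_of_im_pos hw,
          ofComplex_apply_of_im_pos (by simpa using hw)]
        simp [add_comm]
      simp only [Function.comp_apply]
      rw [h2, ← h1]
      simp [denom, toGL_translation_apply]
    -- Off the upper half-plane `ofComplex` takes a single default value, so periodicity is trivial
    -- there.
    · simp only [Function.comp_apply]
      rw [ofComplex_apply_eq_of_im_nonpos (w := w + (2 : ℝ)) (w' := w) (by simpa using hw) hw]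
  have hdec := hzero.exp_decay_atImInfty (h := 2) two_pos hper hhol hzero.isBoundedAtImInfty
  obtain ⟨C, hC, hCO⟩ := hdec.exists_pos
  rw [Asymptotics.IsBigOWith, Filter.Eventually, atImInfty_mem] at hCO
  obtain ⟨A, hA⟩ := hCO
  refine ⟨max 1 A, C * 2, le_max_left _ _, by positivity, fun z hz ↦ ?_⟩
  have h1 : ‖φ z‖ ≤ C * ‖Real.exp (-2 * Real.pi * z.im / 2)‖ := hA z ((le_max_right _ _).trans hz)
  refine h1.trans ?_
  have hz0 := z.im_pos
  rw [Real.norm_eq_abs, abs_of_pos (Real.exp_pos _), mul_div_assoc C]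
  gcongr
  rw [le_div_iff₀ (by positivity)]
  have h2 : z.im ^ 2 / 2 ≤ Real.exp z.im := by
    have := Real.quadratic_le_exp_of_nonneg hz0.le
    linarith
  have h3 : Real.exp (-2 * Real.pi * z.im / 2) ≤ Real.exp (-z.im) := by
    apply Real.exp_le_exp.2
    nlinarith [Real.pi_gt_three]
  calc Real.exp (-2 * Real.pi * z.im / 2) * z.im ^ 2 ≤
      Real.exp (-z.im) * (2 * Real.exp z.im) := by
        gcongr
        linarith
    _ = 2 := by rw [mul_left_comm, ← Real.exp_add]; simp

/-- For a cusp form `f` of weight 2, the function `Im z * |f z|` is bounded. -/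
lemma exists_im_mul_norm_le (hΓ : IsCofiniteFuchsian Γ) {ι : Type*} (C : CuspSystem Γ ι)
    (f : CuspForm (glImage Γ) 2) : ∃ M, 0 ≤ M ∧ ∀ z : ℍ, z.im * ‖f z‖ ≤ M := by
  obtain ⟨S, hS, -, hK⟩ := hΓ.firstKind
  have hhoro : ∀ g ∈ S, ∃ Y M : ℝ, ∀ z ∈ horoball g Y, z.im * ‖f z‖ ≤ M := by
    intro g hg
    obtain ⟨γ, hγ, 𝔞, h𝔞⟩ := C.complete _ (hS g hg)
    obtain ⟨A, B, hA, hB, hAB⟩ := exists_norm_slash_le f (C.isScalingMatrix 𝔞)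
    rw [← boundaryAct_mul, boundaryAct_infty_eq_iff] at h𝔞
    set h := (C.scaling 𝔞)⁻¹ * (γ * g) with hh
    have hd : h 1 1 ≠ 0 := by
      intro hd
      have := h.2
      rw [Matrix.det_fin_two] at this
      simp [h𝔞, hd] at this
    -- The matrix `h` is upper triangular and divides heights by `h 1 1 ^ 2`, so this horoball is
    -- carried above height `A` at the cusp `𝔞`.
    refine ⟨A * h 1 1 ^ 2, B, fun z hz ↦ ?_⟩
    set w : ℍ := (C.scaling 𝔞)⁻¹ • γ • z with hw
    have him : w.im = (g⁻¹ • z).im / h 1 1 ^ 2 := by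
      have e : w = h • g⁻¹ • z := by
        rw [hw, hh]
        simp only [mul_smul, smul_inv_smul]
      rw [e, im_smul_eq_div_normSq_lowerRow, h𝔞]
      simp [Complex.normSq_apply, pow_two]
    have hwA : A ≤ w.im := by
      rw [him, le_div_iff₀ (by positivity)]
      exact le_of_lt hz
    have hzw : γ • z = C.scaling 𝔞 • w := by rw [hw, smul_inv_smul]
    rw [← im_mul_norm_smul_of_mem f hγ, hzw, im_mul_norm_smul]
    have hw0 := w.im_pos
    have h1w : 1 ≤ w.im := hA.trans hwA
    calc w.im * _ ≤ w.im * (B / w.im ^ 2) := by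
          gcongr
          exact hAB w hwA
      _ = B / w.im := by field_simp
      _ ≤ B := div_le_self hB h1w
  choose! Y M hYM using hhoro
  obtain ⟨Y₀, hY₀⟩ := (S.finite_toSet.image Y).bddAbove
  obtain ⟨M₀, hM₀⟩ := (S.finite_toSet.image M).bddAbove
  obtain ⟨K, hKc, hK⟩ := hK Y₀
  have hcont : Continuous fun z : ℍ ↦ z.im * ‖f z‖ :=
    UpperHalfPlane.continuous_im.mul (CuspFormClass.holo f).continuous.norm
  obtain ⟨M₁, hM₁⟩ := hKc.exists_bound_of_continuousOn hcont.continuousOn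
  refine ⟨max 0 (max M₀ M₁), le_max_left _ _, fun z ↦ ?_⟩
  obtain ⟨γ, hγ, h | h⟩ := hK z
  · rw [← im_mul_norm_smul_of_mem f hγ]
    exact (le_abs_self _).trans ((hM₁ _ h).trans ((le_max_right _ _).trans (le_max_right _ _)))
  · simp only [Set.mem_iUnion] at h
    obtain ⟨g, hg, hz⟩ := h
    rw [← im_mul_norm_smul_of_mem f hγ]
    have hz' : γ • z ∈ horoball g (Y g) := lt_of_le_of_lt (hY₀ ⟨g, hg, rfl⟩) hz
    exact (hYM g hg _ hz').trans
      ((hM₀ ⟨g, hg, rfl⟩).trans ((le_max_left _ _).trans (le_max_right _ _)))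

lemma exists_norm_slash_le_both (hΓ : IsCofiniteFuchsian Γ) {ι : Type*} (C : CuspSystem Γ ι)
    (f : CuspForm (glImage Γ) 2) (𝔞 : ι) : ∃ M : ℝ, 0 ≤ M ∧
      (∀ z : ℂ, 0 < z.im → ‖((⇑f) ∣[(2 : ℤ)] (Matrix.SpecialLinearGroup.toGL (C.scaling 𝔞)))
        (ofComplex z)‖ ≤ M / z.im) ∧
      (∀ z : ℂ, 1 ≤ z.im → ‖((⇑f) ∣[(2 : ℤ)] (Matrix.SpecialLinearGroup.toGL (C.scaling 𝔞)))
        (ofComplex z)‖ ≤ M / z.im ^ 2) := by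
  obtain ⟨A, B, hA, hB, hAB⟩ := exists_norm_slash_le f (C.isScalingMatrix 𝔞)
  obtain ⟨M, hM0, hM⟩ := exists_im_mul_norm_le hΓ C f
  have key : ∀ z : ℍ, ‖((⇑f) ∣[(2 : ℤ)] (Matrix.SpecialLinearGroup.toGL (C.scaling 𝔞))) z‖ ≤
      M / z.im := by
    intro z
    rw [le_div_iff₀ z.im_pos, mul_comm, ← im_mul_norm_smul]
    exact hM _
  -- `M * A` covers heights between 1 and `A`, where `M / y ≤ M A / y ^ 2`; `B` covers those above.
  refine ⟨M * A + B, by positivity, fun z hz ↦ ?_, fun z hz ↦ ?_⟩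
  · lift z to ℍ using hz
    rw [ofComplex_apply]
    refine (key z).trans ?_
    have := z.im_pos
    rw [UpperHalfPlane.coe_im]
    gcongr
    nlinarith
  · have hz0 : 0 < z.im := by linarith
    lift z to ℍ using hz0
    rw [ofComplex_apply]
    rw [UpperHalfPlane.coe_im] at hz ⊢
    rcases le_total A z.im with h | h
    · refine (hAB z h).trans ?_
      gcongr
      nlinarith
    · refine (key z).trans ?_
      rw [div_le_div_iff₀ z.im_pos (by positivity)]
      have : M * z.im ≤ M * A + B := by nlinarith
      nlinarith

lemma exists_norm_segmentPrimitive_smul_le (hΓ : IsCofiniteFuchsian Γ) {ι : Type*}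
    (C : CuspSystem Γ ι) (f : CuspForm (glImage Γ) 2) (𝔞 : ι) {ε : ℝ} (hε : 0 < ε) :
    ∃ M, 0 ≤ M ∧ ∀ w : ℍ, ‖segmentPrimitive f (C.scaling 𝔞 • w : ℍ)‖ ≤
      M * max 1 (w.im ^ (-ε)) := by
  obtain ⟨B, hB, h1, h2⟩ := exists_norm_slash_le_both hΓ C f 𝔞
  obtain ⟨M, hM, h⟩ := exists_norm_le_max_one_rpow
    (fun z hz ↦ hasDerivAt_segmentPrimitive_smul (CuspFormClass.holo f) (C.scaling 𝔞) hz)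
    h1 h2 hB hε
  refine ⟨M, hM, fun w ↦ ?_⟩
  simpa only [ofComplex_apply, UpperHalfPlane.coe_im] using h w w.im_pos

/-- In the coordinate of the cusp `τ` is a horizontal translation. The increment of the primitive
along it is the symbol at every height, and it tends to 0 towards the cusp. -/
lemma modularSymbol_eq_zero_of_mem_stab (hΓ : IsCofiniteFuchsian Γ) {ι : Type*}
    (C : CuspSystem Γ ι) (f : CuspForm (glImage Γ) 2) {𝔞 : ι} {τ : Γ} (hτ : τ ∈ C.stab 𝔞) :
    modularSymbol f τ = 0 := by
  obtain ⟨B, hB, h1, h2⟩ := exists_norm_slash_le_both hΓ C f 𝔞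
  obtain ⟨n, hn⟩ := (C.isScalingMatrix 𝔞).eq_translation τ τ.2 hτ
  have hpt : ∀ z : ℍ, (τ : SL(2, ℝ)) • C.scaling 𝔞 • z = C.scaling 𝔞 • ((n : ℝ) +ᵥ z) := by
    intro z
    have e : (τ : SL(2, ℝ)) • C.scaling 𝔞 • z =
        C.scaling 𝔞 • ((C.scaling 𝔞)⁻¹ * τ * C.scaling 𝔞) • z := by
      simp only [mul_smul, smul_inv_smul]
    rw [e]
    rcases hn with hn | hn
    · rw [hn, translation_smul]
    · rw [hn, neg_translation_smul]
  refine eq_zero_of_translation_sub_eq (h := n)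
    (fun z hz ↦ hasDerivAt_segmentPrimitive_smul (CuspFormClass.holo f) (C.scaling 𝔞) hz)
    h1 fun y hy ↦ ?_
  set z : ℍ := ⟨⟨0, y⟩, hy⟩ with hz
  have e0 : ofComplex ⟨0, y⟩ = z := ofComplex_apply_of_im_pos hy
  have e1 : ofComplex ⟨n, y⟩ = (n : ℝ) +ᵥ z := by
    ext
    rw [ofComplex_apply_of_im_pos (z := ⟨n, y⟩) hy, UpperHalfPlane.coe_vadd]
    apply Complex.ext <;> simp [hz]
  rw [e0, e1, ← hpt, segmentPrimitive_smul_sub (CuspFormClass.holo f) (f.slash_toGL_eq τ.2)]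

/-- The modular symbol `⟨γ, f⟩` grows slowly in terms of `Im (σ_𝔞⁻¹ γ z)`. -/
lemma exists_norm_modularSymbol_le (hΓ : IsCofiniteFuchsian Γ) {ι : Type*}
    (C : CuspSystem Γ ι) (f : CuspForm (glImage Γ) 2) (𝔞 : ι) {ε : ℝ} (hε : 0 < ε) :
    ∃ M, 0 ≤ M ∧ ∀ (γ : Γ) (z : ℍ), ‖modularSymbol f γ‖ ≤
      M * max 1 (C.translateIm 𝔞 γ z ^ (-ε)) + ‖segmentPrimitive f z‖ := by
  obtain ⟨M, hM, h⟩ := exists_norm_segmentPrimitive_smul_le hΓ C f 𝔞 hε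
  refine ⟨M, hM, fun γ z ↦ ?_⟩
  rw [← segmentPrimitive_smul_sub (CuspFormClass.holo f) (f.slash_toGL_eq γ.2) z]
  refine (norm_sub_le _ _).trans (add_le_add_left ?_ _)
  have := h ((C.scaling 𝔞)⁻¹ • ((γ : SL(2, ℝ)) • z))
  rwa [smul_inv_smul] at this

end CuspForm

/-! ### Smoothness of series of products of holomorphic and antiholomorphic functions -/

section Smooth

variable {α : Type*} {U : Set ℂ}

/-- `∑ a h conj(k)` converges normally on a neighbourhood of every point of `U`. -/
def LocallyNormallySummable (U : Set ℂ) (a : α → ℂ) (h k : α → ℂ → ℂ) : Prop :=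
  ∀ z ∈ U, ∃ r > 0, Metric.ball z r ⊆ U ∧ ∃ M N : α → ℝ, (∀ q, ∀ w ∈ Metric.ball z r, ‖h q w‖ ≤ M q) ∧
    (∀ q, ∀ w ∈ Metric.ball z r, ‖k q w‖ ≤ N q) ∧ Summable fun q ↦ ‖a q‖ * M q * N q

lemma norm_deriv_le_of_ball {F : ℂ → ℂ} {z w : ℂ} {r B : ℝ} (hr : 0 < r)
    (hF : DifferentiableOn ℂ F (Metric.ball z r)) (hB : ∀ w ∈ Metric.ball z r, ‖F w‖ ≤ B)
    (hw : w ∈ Metric.ball z (r / 2)) : ‖deriv F w‖ ≤ B / (r / 3) := by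
  have hsub : Metric.closedBall w (r / 3) ⊆ Metric.ball z r := by
    refine Metric.closedBall_subset_ball' ?_
    rw [Metric.mem_ball] at hw
    linarith
  refine Complex.norm_deriv_le_of_forall_mem_sphere_norm_le (by positivity) ?_ fun x hx ↦
    hB x (hsub (Metric.sphere_subset_closedBall hx))
  exact (hF.mono hsub).diffContOnCl_ball subset_rfl

/-- By Cauchy's estimate, differentiation costs a constant factor on the half-size disc; with `swap`
this covers `k` as well. -/
lemma LocallyNormallySummable.deriv_left {a : α → ℂ} {h k : α → ℂ → ℂ}
    (hh : ∀ q, DifferentiableOn ℂ (h q) U) (hs : LocallyNormallySummable U a h k) :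
    LocallyNormallySummable U a (fun q ↦ deriv (h q)) k := by
  intro z hz
  obtain ⟨r, hr, hrU, M, N, hM, hN, hsum⟩ := hs z hz
  have hsub : Metric.ball z (r / 2) ⊆ Metric.ball z r := Metric.ball_subset_ball (by linarith)
  refine ⟨r / 2, by positivity, hsub.trans hrU, fun q ↦ M q / (r / 3), N,
    fun q w hw ↦ norm_deriv_le_of_ball hr ((hh q).mono hrU) (hM q) hw,
    fun q w hw ↦ hN q w (hsub hw), ?_⟩
  exact (hsum.mul_right (r / 3)⁻¹).congr fun q ↦ by ring

lemma LocallyNormallySummable.swap {a : α → ℂ} {h k : α → ℂ → ℂ}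
    (hs : LocallyNormallySummable U a h k) : LocallyNormallySummable U a k h := by
  intro z hz
  obtain ⟨r, hr, hrU, M, N, hM, hN, hsum⟩ := hs z hz
  refine ⟨r, hr, hrU, N, M, hN, hM, ?_⟩
  exact hsum.congr fun q ↦ by ring

lemma LocallyNormallySummable.summable {a : α → ℂ} {h k : α → ℂ → ℂ}
    (hs : LocallyNormallySummable U a h k) {z : ℂ} (hz : z ∈ U) :
    Summable fun q ↦ a q * h q z * conj (k q z) := by
  obtain ⟨r, hr, hrU, M, N, hM, hN, hsum⟩ := hs z hz
  refine Summable.of_norm_bounded hsum fun q ↦ ?_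
  have hz' := Metric.mem_ball_self (x := z) hr
  have := (norm_nonneg _).trans (hM q z hz')
  rw [norm_mul, norm_mul, RCLike.norm_conj]
  gcongr
  · exact hM q z hz'
  · exact hN q z hz'

/-- Both coefficients of the derivative are series of the same kind, which permits induction on the
order of smoothness. -/
lemma LocallyNormallySummable.hasFDerivAt {a : α → ℂ} {h k : α → ℂ → ℂ}
    (hh : ∀ q, DifferentiableOn ℂ (h q) U) (hk : ∀ q, DifferentiableOn ℂ (k q) U)
    (hs : LocallyNormallySummable U a h k) {z : ℂ} (hz : z ∈ U) :
    HasFDerivAt (fun w ↦ ∑' q, a q * h q w * conj (k q w))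
      ((∑' q, a q * deriv (h q) z * conj (k q z)) • (1 : ℂ →L[ℝ] ℂ) +
        (∑' q, a q * h q z * conj (deriv (k q) z)) • (Complex.conjCLE : ℂ →L[ℝ] ℂ)) z := by
  obtain ⟨r, hr, hrU, M, N, hM, hN, hsum⟩ := hs z hz
  have hsub : Metric.ball z (r / 2) ⊆ Metric.ball z r := Metric.ball_subset_ball (by linarith)
  have hz' := Metric.mem_ball_self (x := z) (half_pos hr)
  have hderiv : ∀ F : ℂ → ℂ, DifferentiableOn ℂ F U → ∀ w ∈ Metric.ball z (r / 2),
      HasDerivAt F (deriv F w) w := fun F hF w hw ↦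
    (((hF.mono hrU).mono hsub).differentiableAt (Metric.isOpen_ball.mem_nhds hw)).hasDerivAt
  have hterm : ∀ q, ∀ w ∈ Metric.ball z (r / 2),
      HasFDerivAt (fun w ↦ a q * h q w * conj (k q w))
        ((a q * deriv (h q) w * conj (k q w)) • (1 : ℂ →L[ℝ] ℂ) +
          (a q * h q w * conj (deriv (k q) w)) • (Complex.conjCLE : ℂ →L[ℝ] ℂ)) w := by
    intro q w hw
    have h1 := ((hderiv _ (hh q) w hw).const_mul (a q)).complexToReal_fderiv
    have h2 := (Complex.conjCLE.hasFDerivAt (x := k q w)).comp w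
      (hderiv _ (hk q) w hw).complexToReal_fderiv
    refine (h1.mul h2).congr_fderiv ?_
    ext v; simp; ring
  have hbound : ∀ q, ∀ w ∈ Metric.ball z (r / 2),
      ‖(a q * deriv (h q) w * conj (k q w)) • (1 : ℂ →L[ℝ] ℂ) +
          (a q * h q w * conj (deriv (k q) w)) • (Complex.conjCLE : ℂ →L[ℝ] ℂ)‖ ≤
        2 * (r / 3)⁻¹ * (‖a q‖ * M q * N q) := by
    intro q w hw
    have hM0 := (norm_nonneg _).trans (hM q w (hsub hw))
    have b1 := norm_deriv_le_of_ball hr ((hh q).mono hrU) (hM q) hw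
    have b2 := norm_deriv_le_of_ball hr ((hk q).mono hrU) (hN q) hw
    have hone : ‖(1 : ℂ →L[ℝ] ℂ)‖ ≤ 1 := ContinuousLinearMap.norm_id_le
    have hconj : ‖(Complex.conjCLE : ℂ →L[ℝ] ℂ)‖ ≤ 1 := Complex.conjCLE_norm.le
    refine (norm_add_le _ _).trans ?_
    rw [norm_smul, norm_smul, norm_mul, norm_mul, norm_mul, norm_mul, RCLike.norm_conj,
      RCLike.norm_conj]
    calc _ ≤ ‖a q‖ * (M q / (r / 3)) * N q * 1 + ‖a q‖ * M q * (N q / (r / 3)) * 1 := by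
          have hN0 := (norm_nonneg _).trans (hN q w (hsub hw))
          gcongr
          · exact hN q w (hsub hw)
          · exact hM q w (hsub hw)
      _ = _ := by ring
  have key := hasFDerivAt_tsum_of_isPreconnected (hsum.mul_left (2 * (r / 3)⁻¹))
    Metric.isOpen_ball (convex_ball z (r / 2)).isPreconnected hterm hbound hz'
    (hs.summable hz) hz'
  refine key.congr_fderiv ?_
  have s1 := (hs.deriv_left hh).summable hz
  have s2 := ((hs.swap.deriv_left hk).swap).summable hz
  rw [Summable.tsum_add (s1.smul_const _) (s2.smul_const _), s1.tsum_smul_const,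
    s2.tsum_smul_const]

theorem LocallyNormallySummable.contDiffOn_nat (hU : IsOpen U) (n : ℕ) :
    ∀ {a : α → ℂ} {h k : α → ℂ → ℂ}, (∀ q, DifferentiableOn ℂ (h q) U) →
      (∀ q, DifferentiableOn ℂ (k q) U) → LocallyNormallySummable U a h k →
      ContDiffOn ℝ n (fun w ↦ ∑' q, a q * h q w * conj (k q w)) U := by
  induction n with
  | zero =>
    intro a h k hh hk hs
    exact contDiffOn_zero.2 fun z hz ↦
      (hs.hasFDerivAt hh hk hz).continuousAt.continuousWithinAt
  | succ n ih =>
    intro a h k hh hk hs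
    rw [Nat.cast_succ, contDiffOn_succ_iff_fderiv_of_isOpen hU]
    refine ⟨fun z hz ↦ (hs.hasFDerivAt hh hk hz).differentiableAt.differentiableWithinAt,
      by simp, ?_⟩
    have h1 := ih (fun q ↦ (hh q).deriv hU) hk (hs.deriv_left hh)
    have h2 := ih hh (fun q ↦ (hk q).deriv hU) (hs.swap.deriv_left hk).swap
    exact ((h1.smul contDiffOn_const).add (h2.smul contDiffOn_const)).congr
      fun z hz ↦ (hs.hasFDerivAt hh hk hz).fderiv

theorem LocallyNormallySummable.contDiffOn (hU : IsOpen U) {a : α → ℂ} {h k : α → ℂ → ℂ}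
    (hh : ∀ q, DifferentiableOn ℂ (h q) U) (hk : ∀ q, DifferentiableOn ℂ (k q) U)
    (hs : LocallyNormallySummable U a h k) :
    ContDiffOn ℝ ∞ (fun w ↦ ∑' q, a q * h q w * conj (k q w)) U :=
  contDiffOn_infty.2 fun n ↦ LocallyNormallySummable.contDiffOn_nat hU n hh hk hs

end Smooth

/-! ### Powers of imaginary parts of translates -/

/-- If `c ≠ 0` then `c z + d` is never real; if `c = 0` it is a nonzero constant, made positive by
the sign. Its powers are thus holomorphic. -/
lemma exists_sign_mem_slitPlane (g : SL(2, ℝ)) : ∃ e : ℝ, e ^ 2 = 1 ∧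
    ∀ z : ℂ, 0 < z.im → (e * (g 1 0 * z + g 1 1) : ℂ) ∈ Complex.slitPlane := by
  by_cases hc : g 1 0 = 0
  · have hd : g 1 1 ≠ 0 := by
      intro hd
      have := g.2
      rw [Matrix.det_fin_two] at this
      simp [hc, hd] at this
    rcases lt_or_gt_of_ne hd with h | h
    · refine ⟨-1, by norm_num, fun z _ ↦ ?_⟩
      left
      simpa [hc] using h
    · refine ⟨1, by norm_num, fun z _ ↦ ?_⟩
      left
      simpa [hc] using h
  · refine ⟨1, by norm_num, fun z hz ↦ ?_⟩
    right
    simpa using ⟨hc, hz.ne'⟩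

/-- The logarithm of `|u| ^ 2` is `log u + conj (log u)`; the result is a holomorphic times an
antiholomorphic factor. -/
lemma normSq_cpow_neg (u : ℂ) (hu : u ≠ 0) (s : ℂ) :
    ((Complex.normSq u : ℝ) : ℂ) ^ (-s) = u ^ (-s) * conj (u ^ (-conj s)) := by
  have hN : ((Complex.normSq u : ℝ) : ℂ) ≠ 0 := by
    exact_mod_cast (Complex.normSq_pos.2 hu).ne'
  rw [Complex.cpow_def_of_ne_zero hN, Complex.cpow_def_of_ne_zero hu,
    Complex.cpow_def_of_ne_zero hu, ← Complex.exp_conj, ← Complex.exp_add]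
  congr 1
  have h1 : Complex.log ((Complex.normSq u : ℝ) : ℂ) = Complex.log u + conj (Complex.log u) := by
    rw [Complex.add_conj, Complex.log_re, ← Complex.ofReal_log (Complex.normSq_nonneg u),
      Complex.normSq_eq_norm_sq, Real.log_pow]
    simp
  rw [h1]
  simp
  ring

lemma im_smul_cpow (g : SL(2, ℝ)) {e : ℝ} (he : e ^ 2 = 1) (z : ℍ) (s : ℂ) :
    (((g • z).im : ℝ) : ℂ) ^ s = ((z.im : ℝ) : ℂ) ^ s *
      ((e * (g 1 0 * z + g 1 1) : ℂ) ^ (-s) * conj ((e * (g 1 0 * z + g 1 1) : ℂ) ^ (-conj s))) := by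
  set u : ℂ := e * (g 1 0 * z + g 1 1) with hu
  have hN : Complex.normSq u = Complex.normSq ((g 1 0 : ℂ) * z + g 1 1) := by
    rw [hu, Complex.normSq_mul, Complex.normSq_ofReal, ← pow_two, he, one_mul]
  have him := im_smul_eq_div_normSq_lowerRow g z
  rw [← hN] at him
  have hpos : 0 < Complex.normSq u := by
    have h1 := (g • z).im_pos
    rw [him] at h1
    exact (div_pos_iff_of_pos_left z.im_pos).1 h1
  rw [← normSq_cpow_neg u (Complex.normSq_pos.1 hpos), him, div_eq_mul_inv, Complex.ofReal_mul,
    Complex.mul_cpow_ofReal_nonneg z.im_pos.le (inv_nonneg.2 hpos.le), Complex.ofReal_inv,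
    Complex.inv_cpow, Complex.cpow_neg]
  rw [Complex.arg_ofReal_of_nonneg hpos.le]
  exact Real.pi_pos.ne

lemma norm_cpow_le_mul_exp {u s : ℂ} : ‖u ^ s‖ ≤ ‖u‖ ^ s.re * Real.exp (Real.pi * |s.im|) := by
  refine (Complex.norm_cpow_le u s).trans ?_
  rw [div_eq_mul_inv, ← Real.exp_neg]
  gcongr
  calc -(u.arg * s.im) ≤ |u.arg * s.im| := neg_le_abs _
    _ ≤ Real.pi * |s.im| := by
      rw [abs_mul]
      gcongr
      exact Complex.abs_arg_le_pi u

lemma norm_lowerRow_rpow (g : SL(2, ℝ)) {e : ℝ} (he : e ^ 2 = 1) (z : ℍ) (σ : ℝ) :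
    ‖(e * (g 1 0 * z + g 1 1) : ℂ)‖ ^ (-σ) = ((g • z).im / z.im) ^ (σ / 2) := by
  have he1 : |e| = 1 := by
    rwa [← sq_eq_sq₀ (abs_nonneg e) zero_le_one, one_pow, sq_abs]
  rw [im_smul_eq_div_normSq_lowerRow, div_div_cancel_left' z.im_ne_zero, Complex.normSq_eq_norm_sq,
    norm_mul, Complex.norm_real, Real.norm_eq_abs, he1, one_mul, ← Real.rpow_natCast,
    ← Real.rpow_neg (norm_nonneg _), ← Real.rpow_mul (norm_nonneg _)]
  congr 1
  push_cast
  ring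

/-- A series `∑ a Im(g z) ^ s` over matrices `g ∈ SL(2, ℝ)` that converges absolutely at
every point of `ℍ` is a smooth function. -/
theorem contDiffOn_tsum_im_smul_cpow {α : Type*} (a : α → ℂ) (g : α → SL(2, ℝ)) {s : ℂ}
    (hs : 0 ≤ s.re) (hsum : ∀ z : ℍ, Summable fun q ↦ ‖a q‖ * (g q • z).im ^ s.re) :
    ContDiffOn ℝ ∞ (fun w : ℂ ↦ ∑' q, a q * (((g q • ofComplex w).im : ℝ) : ℂ) ^ s)
      {w : ℂ | 0 < w.im} := by
  choose e he hslit using fun q ↦ exists_sign_mem_slitPlane (g q)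
  set u : α → ℂ → ℂ := fun q w ↦ e q * (g q 1 0 * w + g q 1 1) with hu
  have hudiff : ∀ q, ∀ p : ℂ, DifferentiableOn ℂ (fun w ↦ u q w ^ p) {w : ℂ | 0 < w.im} := by
    intro q p w hw
    have : DifferentiableAt ℂ (u q) w := by
      simp only [hu]
      fun_prop
    exact (this.cpow_const (hslit q w hw)).differentiableWithinAt
  have hU := isOpen_upperHalfPlaneSet
  have hlns : LocallyNormallySummable {w : ℂ | 0 < w.im} a (fun q w ↦ u q w ^ (-s))
      (fun q w ↦ u q w ^ (-conj s)) := by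
    intro z hz
    set z₀ : ℍ := ofComplex z with hz₀
    have hcont : ContinuousAt ofComplex z :=
      (mdifferentiableAt_ofComplex hz).continuousAt
    have hnhds : ∀ᶠ w in 𝓝 z, 0 < w.im ∧ dist (ofComplex w) z₀ < 1 :=
      Filter.Eventually.and (hU.mem_nhds hz) (hcont.eventually (Metric.ball_mem_nhds z₀ one_pos))
    obtain ⟨r, hr, hball⟩ := Metric.eventually_nhds_iff_ball.1 hnhds
    -- On a hyperbolic ball of radius 1, `Im (g w)` and `Im w` each change by a factor of at most
    -- `exp 1`, whence `exp 2`. The argument of `u` costs `exp (π |Im s|)`. Each of the two factors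
    -- carries half of the exponent.
    set B : α → ℝ := fun q ↦ (Real.exp 2 / z₀.im * (g q • z₀).im) ^ (s.re / 2) *
      Real.exp (Real.pi * |s.im|) with hB
    have hbd : ∀ q, ∀ w ∈ Metric.ball z r, ∀ p : ℂ, p.re = -s.re → |p.im| = |s.im| →
        ‖u q w ^ p‖ ≤ B q := by
      intro q w hw p hp1 hp2
      obtain ⟨hw0, hwd⟩ := hball w hw
      refine norm_cpow_le_mul_exp.trans ?_
      rw [hp1, hp2, hB]
      simp only
      gcongr
      have hwc : w = ((ofComplex w : ℍ) : ℂ) := by rw [ofComplex_apply_of_im_pos hw0]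
      simp only [hu]
      rw [hwc, norm_lowerRow_rpow (g q) (he q)]
      have i1 := UpperHalfPlane.im_le_im_mul_exp_dist (g q • ofComplex w) (g q • z₀)
      rw [dist_smul] at i1
      have i2 := UpperHalfPlane.im_le_im_mul_exp_dist z₀ (ofComplex w)
      rw [dist_comm] at i2
      have i3 : Real.exp (dist (ofComplex w) z₀) ≤ Real.exp 1 := Real.exp_le_exp.2 hwd.le
      have p1 := (g q • ofComplex w).im_pos
      have p2 := (g q • z₀).im_pos
      have p3 := z₀.im_pos
      have p4 := (ofComplex w).im_pos
      refine Real.rpow_le_rpow (by positivity) ?_ (by linarith)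
      rw [div_le_iff₀ p4]
      have e2 : Real.exp 2 = Real.exp 1 * Real.exp 1 := by rw [← Real.exp_add]; norm_num
      calc (g q • ofComplex w).im ≤ (g q • z₀).im * Real.exp 1 := i1.trans (by gcongr)
        _ = Real.exp 1 * (g q • z₀).im * (z₀.im / z₀.im) := by
          rw [div_self p3.ne']; ring
        _ ≤ Real.exp 1 * (g q • z₀).im * (((ofComplex w).im * Real.exp 1) / z₀.im) := by
          gcongr
          exact i2.trans (by gcongr)
        _ = _ := by rw [e2]; ring
    refine ⟨r, hr, fun w hw ↦ (hball w hw).1, B, B, fun q w hw ↦ hbd q w hw _ (by simp) (by simp),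
      fun q w hw ↦ hbd q w hw _ (by simp) (by simp), ?_⟩
    refine ((hsum z₀).mul_left
      ((Real.exp 2 / z₀.im) ^ s.re * Real.exp (Real.pi * |s.im|) ^ 2)).congr fun q ↦ ?_
    have p2 := (g q • z₀).im_pos
    have p3 := z₀.im_pos
    have e1 : (Real.exp 2 / z₀.im * (g q • z₀).im) ^ (s.re / 2) *
        (Real.exp 2 / z₀.im * (g q • z₀).im) ^ (s.re / 2) =
        (Real.exp 2 / z₀.im) ^ s.re * (g q • z₀).im ^ s.re := by
      rw [← Real.rpow_add (by positivity), add_halves, Real.mul_rpow (by positivity) p2.le]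
    simp only [hB]
    linear_combination -‖a q‖ * Real.exp (Real.pi * |s.im|) ^ 2 * e1
  have hmain := LocallyNormallySummable.contDiffOn hU (fun q ↦ hudiff q _) (fun q ↦ hudiff q _) hlns
  have him : ContDiffOn ℝ ∞ (fun w : ℂ ↦ ((w.im : ℝ) : ℂ) ^ s) {w : ℂ | 0 < w.im} := by
    have h1 : ContDiffOn ℝ ∞ (fun w : ℂ ↦ Complex.exp (((Real.log w.im : ℝ) : ℂ) * s))
        {w : ℂ | 0 < w.im} := by
      refine ContDiffOn.cexp (ContDiffOn.mul ?_ contDiffOn_const)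
      refine Complex.ofRealCLM.contDiff.comp_contDiffOn ?_
      exact ContDiffOn.log Complex.imCLM.contDiff.contDiffOn fun w hw ↦ ne_of_gt hw
    refine h1.congr fun w hw ↦ ?_
    have hw' : 0 < w.im := hw
    rw [Complex.cpow_def_of_ne_zero (by exact_mod_cast hw'.ne'), Complex.ofReal_log hw'.le]
  refine (him.mul hmain).congr fun w hw ↦ ?_
  rw [← tsum_mul_left]
  refine tsum_congr fun q ↦ ?_
  rw [im_smul_cpow (g q) (he q)]
  have hwc : ((ofComplex w : ℍ) : ℂ) = w := by rw [ofComplex_apply_of_im_pos hw]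
  have hwi : (ofComplex w : ℍ).im = w.im := by rw [← UpperHalfPlane.coe_im, hwc]
  rw [hwc, hwi]
  simp only [hu]
  ring

/-! ### The series -/

section Series

variable {Γ : Subgroup SL(2, ℝ)} {ι : Type*}

/-- The absolute value of the coefficient `χ(γ) ⟨γ, f⟩ ^ m conj(⟨γ, g⟩) ^ n`. -/
noncomputable def symbolWeight (f g : ℍ → ℂ) (m n : ℕ) (γ : SL(2, ℝ)) : ℝ :=
  ‖modularSymbol f γ‖ ^ m * ‖modularSymbol g γ‖ ^ n

lemma symbolWeight_nonneg (f g : ℍ → ℂ) (m n : ℕ) (γ : SL(2, ℝ)) :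
    0 ≤ symbolWeight f g m n γ := by
  unfold symbolWeight
  positivity

lemma norm_eisensteinSummand (C : CuspSystem Γ ι) (f g : ℍ → ℂ) (χ : Γ →* Circle) (m n : ℕ)
    (𝔞 : ι) (γ : Γ) (z : ℍ) (s : ℂ) :
    ‖eisensteinSummand C f g χ m n 𝔞 γ z s‖ =
      symbolWeight f g m n γ * C.translateIm 𝔞 γ z ^ s.re := by
  rw [eisensteinSummand, norm_mul, norm_mul, norm_mul, norm_pow, norm_pow, RCLike.norm_conj,
    Circle.norm_coe, one_mul, Complex.norm_cpow_eq_rpow_re_of_pos (UpperHalfPlane.im_pos _)]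
  rfl

lemma eisensteinSummand_stab_mul (hΓ : IsCofiniteFuchsian Γ) (C : CuspSystem Γ ι)
    (f g : CuspForm (glImage Γ) 2) {χ : Γ →* Circle} (m n : ℕ) {𝔞 : ι}
    (hχ : ∀ τ ∈ C.stab 𝔞, χ τ = 1) {τ : Γ} (hτ : τ ∈ C.stab 𝔞) (γ : Γ) (z : ℍ) (s : ℂ) :
    eisensteinSummand C f g χ m n 𝔞 (τ * γ) z s = eisensteinSummand C f g χ m n 𝔞 γ z s := by
  have him := C.translateIm_stab_mul 𝔞 hτ γ z
  rw [CuspSystem.translateIm, CuspSystem.translateIm] at him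
  have hmul : ∀ f : CuspForm (glImage Γ) 2,
      modularSymbol f ((τ * γ : Γ) : SL(2, ℝ)) = modularSymbol f γ := by
    intro f
    rw [Subgroup.coe_mul, modularSymbol_mul (CuspFormClass.holo f) (f.slash_toGL_eq τ.2),
      modularSymbol_eq_zero_of_mem_stab hΓ C f hτ, zero_add]
  rw [eisensteinSummand, eisensteinSummand, him, hmul, hmul, map_mul, hχ τ hτ, one_mul]

/-- This removes the only term that could be large near a cusp. -/
lemma symbolWeight_eq_zero_of_mem_stab (hΓ : IsCofiniteFuchsian Γ) (C : CuspSystem Γ ι)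
    (f g : CuspForm (glImage Γ) 2) {m n : ℕ} (hmn : (m, n) ≠ (0, 0)) {𝔞 : ι} {τ : Γ}
    (hτ : τ ∈ C.stab 𝔞) : symbolWeight f g m n τ = 0 := by
  rw [symbolWeight, modularSymbol_eq_zero_of_mem_stab hΓ C f hτ,
    modularSymbol_eq_zero_of_mem_stab hΓ C g hτ, norm_zero, ← pow_add]
  apply zero_pow
  intro h
  apply hmn
  ext <;> simp <;> omega

lemma exists_symbolWeight_le (hΓ : IsCofiniteFuchsian Γ) (C : CuspSystem Γ ι)
    (f g : CuspForm (glImage Γ) 2) {m n : ℕ} (hmn : (m, n) ≠ (0, 0)) (𝔞 : ι) {ε : ℝ} (hε : 0 < ε)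
    {B : ℝ} (hB : 0 ≤ B) : ∃ M, 0 ≤ M ∧ ∀ (γ : Γ) (z : ℍ), ‖segmentPrimitive f z‖ ≤ B →
      ‖segmentPrimitive g z‖ ≤ B → C.translateIm 𝔞 γ z ≤ 1 →
      symbolWeight f g m n γ ≤ M * C.translateIm 𝔞 γ z ^ (-ε) := by
  have hk : (0 : ℝ) < m + n := by
    have : m + n ≠ 0 := by
      intro h
      apply hmn
      ext <;> simp <;> omega
    exact_mod_cast Nat.pos_of_ne_zero this
  -- The loss `ε` is shared equally among the `m + n` symbols.
  have hε' : 0 < ε / (m + n) := by positivity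
  have key : ∀ f : CuspForm (glImage Γ) 2, ∃ M, 0 ≤ M ∧ ∀ (γ : Γ) (z : ℍ),
      ‖segmentPrimitive f z‖ ≤ B → C.translateIm 𝔞 γ z ≤ 1 →
      ‖modularSymbol f γ‖ ≤ M * C.translateIm 𝔞 γ z ^ (-(ε / (m + n))) := by
    intro f
    obtain ⟨M, hM, h⟩ := exists_norm_modularSymbol_le hΓ C f 𝔞 hε'
    refine ⟨M + B, by positivity, fun γ z hz hy ↦ ?_⟩
    have h1 : 1 ≤ C.translateIm 𝔞 γ z ^ (-(ε / (m + n))) :=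
      Real.one_le_rpow_of_pos_of_le_one_of_nonpos (C.translateIm_pos 𝔞 γ z) hy (by linarith)
    have h2 := h γ z
    rw [max_eq_right h1] at h2
    nlinarith
  obtain ⟨M₁, hM₁, h₁⟩ := key f
  obtain ⟨M₂, hM₂, h₂⟩ := key g
  refine ⟨M₁ ^ m * M₂ ^ n, by positivity, fun γ z hf hg hy ↦ ?_⟩
  have hy0 := C.translateIm_pos 𝔞 γ z
  have e : (C.translateIm 𝔞 γ z ^ (-(ε / (m + n)))) ^ m *
      (C.translateIm 𝔞 γ z ^ (-(ε / (m + n)))) ^ n = C.translateIm 𝔞 γ z ^ (-ε) := by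
    rw [← pow_add, ← Real.rpow_natCast, ← Real.rpow_mul hy0.le]
    congr 1
    push_cast
    field_simp
  calc symbolWeight f g m n γ ≤ (M₁ * C.translateIm 𝔞 γ z ^ (-(ε / (m + n)))) ^ m *
      (M₂ * C.translateIm 𝔞 γ z ^ (-(ε / (m + n)))) ^ n := by
        unfold symbolWeight
        gcongr
        · exact h₁ γ z hf hy
        · exact h₂ γ z hg hy
    _ = M₁ ^ m * M₂ ^ n * C.translateIm 𝔞 γ z ^ (-ε) := by rw [← e]; ring

lemma summable_symbolWeight_mul (hΓ : IsCofiniteFuchsian Γ) (C : CuspSystem Γ ι)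
    (f g : CuspForm (glImage Γ) 2) {m n : ℕ} (hmn : (m, n) ≠ (0, 0)) (𝔞 : ι) (z : ℍ) {σ : ℝ}
    (hσ : 1 < σ) : Summable fun q : CuspCoset C 𝔞 ↦
      symbolWeight f g m n (q.out : Γ) * C.translateIm 𝔞 q.out z ^ σ := by
  -- Half of the room above 1, so that `σ - ε > 1`; the finitely many cosets of height at least 1 do
  -- not affect summability.
  set ε := (σ - 1) / 2 with hε
  have hε0 : 0 < ε := by linarith
  obtain ⟨M, hM, h⟩ := exists_symbolWeight_le hΓ C f g hmn 𝔞 hε0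
    (B := max ‖segmentPrimitive f z‖ ‖segmentPrimitive g z‖) (by positivity)
  have hsum := (C.summable_translateIm_rpow hΓ.discrete 𝔞 z (σ := σ - ε) (by linarith)).mul_left M
  refine Summable.of_norm_bounded_eventually hsum ?_
  have hfin := C.finite_setOf_le_translateIm hΓ.discrete 𝔞 z one_pos
  filter_upwards [hfin.compl_mem_cofinite] with q hq
  have hq1 : C.translateIm 𝔞 q.out z ≤ 1 := (lt_of_not_ge fun h ↦ hq h).le
  have hy0 := C.translateIm_pos 𝔞 q.out z
  rw [Real.norm_eq_abs, abs_of_nonneg (mul_nonneg (symbolWeight_nonneg _ _ _ _ _)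
    (Real.rpow_nonneg hy0.le _))]
  calc _ ≤ M * C.translateIm 𝔞 q.out z ^ (-ε) * C.translateIm 𝔞 q.out z ^ σ := by
        gcongr
        exact h _ z (le_max_left _ _) (le_max_right _ _) hq1
    _ = M * C.translateIm 𝔞 q.out z ^ (σ - ε) := by
        rw [mul_assoc, ← Real.rpow_add hy0, neg_add_eq_sub]

lemma summable_norm_eisensteinTerm (hΓ : IsCofiniteFuchsian Γ) (C : CuspSystem Γ ι)
    (f g : CuspForm (glImage Γ) 2) (χ : Γ →* Circle) {m n : ℕ} (hmn : (m, n) ≠ (0, 0)) (𝔞 : ι)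
    (z : ℍ) {s : ℂ} (hs : 1 < s.re) :
    Summable fun q : CuspCoset C 𝔞 ↦ ‖eisensteinTerm C f g χ m n 𝔞 q z s‖ := by
  simp only [eisensteinTerm, norm_eisensteinSummand]
  exact summable_symbolWeight_mul hΓ C f g hmn 𝔞 z hs

lemma exists_dist_I_le {K : Set ℍ} (hK : IsCompact K) : ∃ d : ℝ, ∀ z ∈ K, dist z I ≤ d := by
  obtain ⟨d, hd⟩ := hK.isBounded.subset_closedBall I
  exact ⟨d, fun z hz ↦ hd hz⟩

lemma summable_symbolWeight_mul_const (hΓ : IsCofiniteFuchsian Γ) (C : CuspSystem Γ ι)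
    (f g : CuspForm (glImage Γ) 2) {m n : ℕ} (hmn : (m, n) ≠ (0, 0)) (𝔞 : ι) (z : ℍ) {σ : ℝ}
    (hσ : 1 < σ) {B : ℝ} (hB : 0 ≤ B) : Summable fun q : CuspCoset C 𝔞 ↦
      symbolWeight f g m n (q.out : Γ) * (C.translateIm 𝔞 q.out z * B) ^ σ := by
  refine ((summable_symbolWeight_mul hΓ C f g hmn 𝔞 z hσ).mul_right (B ^ σ)).congr fun q ↦ ?_
  rw [Real.mul_rpow (C.translateIm_pos 𝔞 _ z).le hB, mul_assoc]

theorem tendstoUniformlyOn_eisenstein (hΓ : IsCofiniteFuchsian Γ) (C : CuspSystem Γ ι)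
    (f g : CuspForm (glImage Γ) 2) (χ : Γ →* Circle) {m n : ℕ} (hmn : (m, n) ≠ (0, 0)) (𝔞 : ι)
    {K : Set ℍ} (hK : IsCompact K) {δ : ℝ} (hδ : 0 < δ) :
    TendstoUniformlyOn
      (fun (T : Finset (CuspCoset C 𝔞)) (p : ℍ × ℂ) ↦
        ∑ q ∈ T, eisensteinTerm C f g χ m n 𝔞 q p.1 p.2)
      (fun p ↦ higherEisenstein C f g χ m n 𝔞 p.1 p.2)
      atTop (K ×ˢ {s : ℂ | 1 + δ ≤ s.re}) := by
  obtain ⟨d, hd⟩ := exists_dist_I_le hK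
  refine tendstoUniformlyOn_tsum_of_cofinite_eventually
    (summable_symbolWeight_mul_const hΓ C f g hmn 𝔞 I (σ := 1 + δ) (by linarith)
      (Real.exp_pos d).le) ?_
  -- Outside this finite set all heights over `K` are at most 1, so among the exponents `Re s ≥ 1 +
  -- δ` the smallest gives the largest power.
  have hfin := C.finite_setOf_le_translateIm hΓ.discrete 𝔞 I (t := Real.exp (-d)) (Real.exp_pos _)
  filter_upwards [hfin.compl_mem_cofinite] with q hq
  rintro ⟨z, s⟩ ⟨hz, hs⟩
  have hs' : 1 + δ ≤ s.re := hs
  have hq1 : C.translateIm 𝔞 q.out I * Real.exp d ≤ 1 := by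
    have h1 : C.translateIm 𝔞 q.out I < Real.exp (-d) := lt_of_not_ge fun h ↦ hq h
    calc _ ≤ Real.exp (-d) * Real.exp d := by gcongr
      _ = 1 := by rw [← Real.exp_add]; simp
  have hzq : C.translateIm 𝔞 q.out z ≤ C.translateIm 𝔞 q.out I * Real.exp d :=
    (C.translateIm_le_mul_exp_dist 𝔞 _ z I).trans
      (mul_le_mul_of_nonneg_left (Real.exp_le_exp.2 (hd z hz)) (C.translateIm_pos 𝔞 _ I).le)
  have hz0 := C.translateIm_pos 𝔞 q.out z
  rw [eisensteinTerm, norm_eisensteinSummand]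
  refine mul_le_mul_of_nonneg_left ?_ (symbolWeight_nonneg _ _ _ _ _)
  calc _ ≤ C.translateIm 𝔞 q.out z ^ (1 + δ) :=
        Real.rpow_le_rpow_of_exponent_ge hz0 (hzq.trans hq1) hs'
    _ ≤ _ := Real.rpow_le_rpow hz0.le hzq (by linarith)

theorem contDiffOn_higherEisenstein (hΓ : IsCofiniteFuchsian Γ) (C : CuspSystem Γ ι)
    (f g : CuspForm (glImage Γ) 2) (χ : Γ →* Circle) {m n : ℕ} (hmn : (m, n) ≠ (0, 0)) (𝔞 : ι)
    {s : ℂ} (hs : 1 < s.re) :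
    ContDiffOn ℝ ∞ (fun w : ℂ ↦ higherEisenstein C f g χ m n 𝔞 (ofComplex w) s)
      {w : ℂ | 0 < w.im} := by
  have := contDiffOn_tsum_im_smul_cpow
    (fun q : CuspCoset C 𝔞 ↦ (χ q.out : ℂ) * modularSymbol f (q.out : Γ) ^ m *
      conj (modularSymbol g (q.out : Γ)) ^ n)
    (fun q ↦ (C.scaling 𝔞)⁻¹ * ((q.out : Γ) : SL(2, ℝ))) (s := s) (by linarith) ?_
  · simp only [mul_smul] at this
    exact this
  · intro z
    refine (summable_norm_eisensteinTerm hΓ C f g χ hmn 𝔞 z hs).congr fun q ↦ ?_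
    rw [eisensteinTerm, norm_eisensteinSummand, mul_smul, norm_mul, norm_mul, norm_pow, norm_pow,
      RCLike.norm_conj, Circle.norm_coe, one_mul]
    rfl

theorem differentiableOn_higherEisenstein (hΓ : IsCofiniteFuchsian Γ) (C : CuspSystem Γ ι)
    (f g : CuspForm (glImage Γ) 2) (χ : Γ →* Circle) {m n : ℕ} (hmn : (m, n) ≠ (0, 0)) (𝔞 : ι)
    (z : ℍ) : DifferentiableOn ℂ (fun s ↦ higherEisenstein C f g χ m n 𝔞 z s)
      {s : ℂ | 1 < s.re} := by
  intro s hs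
  have hs' : 1 < s.re := hs
  set δ := (s.re - 1) / 2 with hδ
  have hδ0 : 0 < δ := by linarith
  have hV : IsOpen {w : ℂ | 1 + δ < w.re} := isOpen_lt continuous_const Complex.continuous_re
  have hunif : TendstoUniformlyOn (fun (T : Finset (CuspCoset C 𝔞)) (w : ℂ) ↦
      ∑ q ∈ T, eisensteinTerm C f g χ m n 𝔞 q z w)
      (fun w ↦ higherEisenstein C f g χ m n 𝔞 z w) atTop {w : ℂ | 1 + δ < w.re} :=
    ((tendstoUniformlyOn_eisenstein hΓ C f g χ hmn 𝔞 (isCompact_singleton (x := z)) hδ0).comp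
      (fun w : ℂ ↦ (z, w))).mono fun w hw ↦ ⟨rfl, show 1 + δ ≤ w.re from le_of_lt hw⟩
  have hdiff := hunif.tendstoLocallyUniformlyOn.differentiableOn (.of_forall fun T ↦ ?_) hV
  · refine (hdiff.differentiableAt (hV.mem_nhds ?_)).differentiableWithinAt
    show 1 + δ < s.re
    linarith
  · refine Differentiable.differentiableOn ?_
    refine Differentiable.fun_sum fun q _ ↦ ?_
    unfold eisensteinTerm eisensteinSummand
    refine Differentiable.const_mul (fun w ↦ ?_) _
    refine DifferentiableAt.const_cpow differentiableAt_id (Or.inl ?_)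
    exact_mod_cast (UpperHalfPlane.im_pos _).ne'

/-! ### Growth on a fundamental domain -/

lemma norm_higherEisenstein_le_tsum (hΓ : IsCofiniteFuchsian Γ) (C : CuspSystem Γ ι)
    (f g : CuspForm (glImage Γ) 2) (χ : Γ →* Circle) {m n : ℕ} (hmn : (m, n) ≠ (0, 0)) (𝔞 : ι)
    (z : ℍ) {s : ℂ} (hs : 1 < s.re) : ‖higherEisenstein C f g χ m n 𝔞 z s‖ ≤
      ∑' q : CuspCoset C 𝔞, symbolWeight f g m n (q.out : Γ) * C.translateIm 𝔞 q.out z ^ s.re := by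
  refine (norm_tsum_le_tsum_norm (summable_norm_eisensteinTerm hΓ C f g χ hmn 𝔞 z hs)).trans_eq ?_
  simp only [eisensteinTerm, norm_eisensteinSummand]

lemma exists_tsum_le_of_isCompact (hΓ : IsCofiniteFuchsian Γ) (C : CuspSystem Γ ι)
    (f g : CuspForm (glImage Γ) 2) {m n : ℕ} (hmn : (m, n) ≠ (0, 0)) (𝔞 : ι) {K : Set ℍ}
    (hK : IsCompact K) {σ : ℝ} (hσ : 1 < σ) : ∃ A, 0 ≤ A ∧ ∀ z ∈ K,
      ∑' q : CuspCoset C 𝔞, symbolWeight f g m n (q.out : Γ) * C.translateIm 𝔞 q.out z ^ σ ≤ A := by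
  obtain ⟨d, hd⟩ := exists_dist_I_le hK
  have hsum := summable_symbolWeight_mul_const hΓ C f g hmn 𝔞 I hσ (Real.exp_pos d).le
  refine ⟨_, tsum_nonneg fun q ↦ mul_nonneg (symbolWeight_nonneg _ _ _ _ _) (Real.rpow_nonneg
    (mul_nonneg (C.translateIm_pos 𝔞 _ I).le (Real.exp_pos d).le) _), fun z hz ↦
    (summable_symbolWeight_mul hΓ C f g hmn 𝔞 z hσ).tsum_le_tsum (fun q ↦ ?_) hsum⟩
  refine mul_le_mul_of_nonneg_left ?_ (symbolWeight_nonneg _ _ _ _ _)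
  refine Real.rpow_le_rpow (C.translateIm_pos 𝔞 _ z).le ?_ (by linarith)
  exact (C.translateIm_le_mul_exp_dist 𝔞 _ z I).trans
    (mul_le_mul_of_nonneg_left (Real.exp_le_exp.2 (hd z hz)) (C.translateIm_pos 𝔞 _ I).le)

lemma CuspSystem.height_le_mul_exp_dist [Finite ι] [Nonempty ι] (C : CuspSystem Γ ι) (z w : ℍ) :
    C.height z ≤ C.height w * Real.exp (dist z w) := by
  refine ciSup_le fun 𝔞 ↦ ?_
  have h := UpperHalfPlane.im_le_im_mul_exp_dist ((C.scaling 𝔞)⁻¹ • z) ((C.scaling 𝔞)⁻¹ • w)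
  rw [dist_smul] at h
  exact h.trans (mul_le_mul_of_nonneg_right (C.le_height 𝔞 w) (Real.exp_pos _).le)

/-- Both signs of `p` are needed, since `1 - σ + ε` may have either. -/
lemma CuspSystem.exists_le_height_rpow [Finite ι] [Nonempty ι] (C : CuspSystem Γ ι) {K : Set ℍ}
    (hK : IsCompact K) (p : ℝ) : ∃ c, 0 < c ∧ ∀ z ∈ K, c ≤ C.height z ^ p := by
  obtain ⟨d, hd⟩ := exists_dist_I_le hK
  have h0 := C.height_pos (Classical.arbitrary ι)
  have hI := h0 I
  rcases le_total 0 p with hp | hp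
  · refine ⟨(C.height I * Real.exp (-d)) ^ p, by positivity, fun z hz ↦ ?_⟩
    refine Real.rpow_le_rpow (by positivity) ?_ hp
    have h1 := C.height_le_mul_exp_dist I z
    rw [Real.exp_neg, ← div_eq_mul_inv, div_le_iff₀ (Real.exp_pos d)]
    refine h1.trans (mul_le_mul_of_nonneg_left (Real.exp_le_exp.2 ?_) (h0 z).le)
    rw [dist_comm]
    exact hd z hz
  · refine ⟨(C.height I * Real.exp d) ^ p, by positivity, fun z hz ↦ ?_⟩
    refine Real.rpow_le_rpow_of_nonpos (h0 z) ?_ hp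
    exact (C.height_le_mul_exp_dist z I).trans
      (mul_le_mul_of_nonneg_left (Real.exp_le_exp.2 (hd z hz)) hI.le)

lemma exists_tsum_le_of_zone [Finite ι] (hΓ : IsCofiniteFuchsian Γ) (C : CuspSystem Γ ι)
    (f g : CuspForm (glImage Γ) 2) {m n : ℕ} (hmn : (m, n) ≠ (0, 0)) (𝔞 : ι) {σ : ℝ} (hσ : 1 < σ)
    {ε : ℝ} (hε : 0 < ε) : ∃ A, 0 ≤ A ∧ ∀ (𝔟 : ι) (w : ℍ), 4 ≤ w.im →
      ∑' q : CuspCoset C 𝔞, symbolWeight f g m n (q.out : Γ) *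
        C.translateIm 𝔞 q.out (C.scaling 𝔟 • w) ^ σ ≤ A * w.im ^ (1 - σ + ε) := by
  classical
  have hprim : ∀ f : CuspForm (glImage Γ) 2, ∃ B, ∀ (𝔟 : ι) (w : ℍ), 1 ≤ w.im →
      ‖segmentPrimitive f (C.scaling 𝔟 • w : ℍ)‖ ≤ B := by
    intro f
    choose M hM h using fun 𝔟 ↦ exists_norm_segmentPrimitive_smul_le hΓ C f 𝔟 one_pos
    obtain ⟨B, hB⟩ := (Set.finite_range M).bddAbove
    refine ⟨B, fun 𝔟 w hw ↦ (h 𝔟 w).trans ?_⟩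
    rw [max_eq_left (Real.rpow_le_one_of_one_le_of_nonpos hw (by norm_num)), mul_one]
    exact hB ⟨𝔟, rfl⟩
  obtain ⟨B₁, hB₁⟩ := hprim f
  obtain ⟨B₂, hB₂⟩ := hprim g
  -- The second bound keeps `σ - κ > 1` even when `ε` is large.
  set κ := min ε ((σ - 1) / 2) with hκ
  have hκ0 : 0 < κ := lt_min hε (by linarith)
  have hκ1 : κ ≤ ε := min_le_left _ _
  have hκ2 : κ ≤ (σ - 1) / 2 := min_le_right _ _
  obtain ⟨M, hM, hw⟩ := exists_symbolWeight_le hΓ C f g hmn 𝔞 hκ0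
    (B := max 0 (max B₁ B₂)) (le_max_left _ _)
  have hr : (2 : ℝ) ^ (1 - (σ - κ)) ≤ 1 :=
    Real.rpow_le_one_of_one_le_of_nonpos (by norm_num) (by linarith)
  set c := 24 * (2 * (1 - (2 : ℝ) ^ (1 - (σ - κ)))⁻¹) with hc
  have hc0 : 0 ≤ c := by
    have : 0 ≤ (1 - (2 : ℝ) ^ (1 - (σ - κ)))⁻¹ := inv_nonneg.2 (by linarith)
    positivity
  refine ⟨M * c * 4 ^ (σ - κ - 1), by positivity, fun 𝔟 w hw4 ↦ ?_⟩
  have hw0 := w.im_pos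
  set z : ℍ := C.scaling 𝔟 • w with hz
  have hnn : ∀ q : CuspCoset C 𝔞, 0 ≤ symbolWeight f g m n (q.out : Γ) *
      C.translateIm 𝔞 q.out z ^ σ := fun q ↦
    mul_nonneg (symbolWeight_nonneg _ _ _ _ _) (Real.rpow_nonneg (C.translateIm_pos 𝔞 _ z).le _)
  refine (summable_symbolWeight_mul hΓ C f g hmn 𝔞 z hσ).tsum_le_of_sum_le fun T ↦ ?_
  set P : CuspCoset C 𝔞 → Prop :=
    fun q ↦ ((C.scaling 𝔞)⁻¹ * (q.out : Γ) * C.scaling 𝔟) 1 0 ≠ 0 with hP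
  -- Terms with lower left entry 0 belong to `Γ_𝔞`, where the weight vanishes.
  have hfilter : ∑ q ∈ T, symbolWeight f g m n (q.out : Γ) * C.translateIm 𝔞 q.out z ^ σ =
      ∑ q ∈ T.filter P, symbolWeight f g m n (q.out : Γ) * C.translateIm 𝔞 q.out z ^ σ := by
    refine (Finset.sum_filter_of_ne (p := P) fun q _ hne h0 ↦ hne ?_).symm
    obtain ⟨-, hmem⟩ := C.eq_and_mem_stab_of_lowerLeft_eq_zero h0
    rw [symbolWeight_eq_zero_of_mem_stab hΓ C f g hmn hmem, zero_mul]
  rw [hfilter]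
  have hterm : ∀ q ∈ T.filter P, symbolWeight f g m n (q.out : Γ) * C.translateIm 𝔞 q.out z ^ σ ≤
      M * C.translateIm 𝔞 q.out z ^ (σ - κ) := by
    intro q hq
    have hy0 := C.translateIm_pos 𝔞 q.out z
    have hy1 : C.translateIm 𝔞 q.out z ≤ 1 :=
      (C.translateIm_le_of_lowerLeft_ne_zero hΓ.discrete 𝔞 𝔟 _ (Finset.mem_filter.1 hq).2 w).trans
        (div_le_one_of_le₀ hw4 hw0.le)
    calc _ ≤ M * C.translateIm 𝔞 q.out z ^ (-κ) * C.translateIm 𝔞 q.out z ^ σ := by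
          gcongr
          refine hw _ z ?_ ?_ hy1
          · exact (hB₁ 𝔟 w (by linarith)).trans ((le_max_left _ _).trans (le_max_right _ _))
          · exact (hB₂ 𝔟 w (by linarith)).trans ((le_max_right _ _).trans (le_max_right _ _))
      _ = _ := by rw [mul_assoc, ← Real.rpow_add hy0, neg_add_eq_sub]
  refine (Finset.sum_le_sum hterm).trans ?_
  rw [← Finset.mul_sum]
  have hE := C.sum_translateIm_rpow_le hΓ.discrete 𝔞 𝔟 (σ := σ - κ) (by linarith) w
    (by linarith) (T.filter P) fun q hq ↦ (Finset.mem_filter.1 hq).2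
  calc _ ≤ M * (c * (4 / w.im) ^ (σ - κ - 1)) := by gcongr
    _ = M * c * 4 ^ (σ - κ - 1) * w.im ^ (1 - σ + κ) := by
        rw [Real.div_rpow (by norm_num) hw0.le, div_eq_mul_inv, ← Real.rpow_neg hw0.le]
        ring_nf
    _ ≤ M * c * 4 ^ (σ - κ - 1) * w.im ^ (1 - σ + ε) := by
        gcongr
        linarith

lemma isCompact_box (Y Y' : ℝ) (hY : 0 < Y) :
    IsCompact {w : ℍ | |w.re| ≤ 1 / 2 ∧ Y ≤ w.im ∧ w.im ≤ Y'} := by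
  rw [isEmbedding_coe.isCompact_iff]
  have : ((↑) : ℍ → ℂ) '' {w : ℍ | |w.re| ≤ 1 / 2 ∧ Y ≤ w.im ∧ w.im ≤ Y'} =
      Set.Icc (-(1 / 2)) (1 / 2) ×ℂ Set.Icc Y Y' := by
    ext w
    simp only [Set.mem_image, Set.mem_ofPred_eq, Complex.mem_reProdIm, Set.mem_Icc, ← abs_le]
    constructor
    · rintro ⟨w, h, rfl⟩
      exact h
    · intro h
      exact ⟨⟨w, hY.trans_le h.2.1⟩, h, rfl⟩
  rw [this]
  exact isCompact_Icc.reProdIm isCompact_Icc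

/-- The part of a zone between two heights is compact, so the cut-off may be raised at will. -/
lemma CuspSystem.IsFundamentalDomain.exists_isCompact [Finite ι] {C : CuspSystem Γ ι} {F : Set ℍ}
    (hF : C.IsFundamentalDomain F) (Y' : ℝ) : ∃ K : Set ℍ, IsCompact K ∧
      ∀ z ∈ F, z ∈ K ∨ ∃ 𝔟, ∃ w : ℍ, Y' ≤ w.im ∧ z = C.scaling 𝔟 • w := by
  obtain ⟨Y, hY, -, K, hK, hFK⟩ := hF.zones
  refine ⟨K ∪ ⋃ 𝔟, (fun w : ℍ ↦ C.scaling 𝔟 • w) ''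
    {w : ℍ | |w.re| ≤ 1 / 2 ∧ Y ≤ w.im ∧ w.im ≤ Y'}, hK.union (isCompact_iUnion fun 𝔟 ↦
      (isCompact_box Y Y' hY).image (continuous_const_smul _)), fun z hz ↦ ?_⟩
  rcases hFK hz with h | h
  · exact Or.inl (Or.inl h)
  · obtain ⟨𝔟, h1, h2⟩ := Set.mem_iUnion.1 h
    rcases le_total Y' ((C.scaling 𝔟)⁻¹ • z).im with h3 | h3
    · exact Or.inr ⟨𝔟, _, h3, (smul_inv_smul _ _).symm⟩
    · exact Or.inl (Or.inr (Set.mem_iUnion.2 ⟨𝔟, _, ⟨h1, h2, h3⟩, smul_inv_smul _ _⟩))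

theorem exists_norm_higherEisenstein_le [Finite ι] (hΓ : IsCofiniteFuchsian Γ)
    (C : CuspSystem Γ ι) (f g : CuspForm (glImage Γ) 2) {m n : ℕ} (hmn : (m, n) ≠ (0, 0))
    {F : Set ℍ} (hF : C.IsFundamentalDomain F) {σ : ℝ} (hσ : 1 < σ) {ε : ℝ} (hε : 0 < ε) (𝔞 : ι) :
    ∃ A : ℝ, ∀ (χ : Γ →* Circle) (s : ℂ), s.re = σ → ∀ z ∈ F,
      ‖higherEisenstein C f g χ m n 𝔞 z s‖ ≤ A * C.height z ^ (1 - σ + ε) := by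
  have : Nonempty ι := ⟨𝔞⟩
  obtain ⟨K, hK, hFK⟩ := hF.exists_isCompact 4
  obtain ⟨A₁, hA₁, h₁⟩ := exists_tsum_le_of_isCompact hΓ C f g hmn 𝔞 hK hσ
  obtain ⟨c, hc, hcK⟩ := C.exists_le_height_rpow hK (1 - σ + ε)
  obtain ⟨A₂, hA₂, h₂⟩ := exists_tsum_le_of_zone hΓ C f g hmn 𝔞 hσ hε
  refine ⟨A₁ / c + A₂, fun χ s hs z hz ↦ ?_⟩
  have hle := norm_higherEisenstein_le_tsum hΓ C f g χ hmn 𝔞 z (s := s) (by linarith)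
  rw [hs] at hle
  refine hle.trans ?_
  have hp := Real.rpow_nonneg (C.height_pos 𝔞 z).le (1 - σ + ε)
  rcases hFK z hz with hzK | ⟨𝔟, w, hw, rfl⟩
  · calc _ ≤ A₁ := h₁ z hzK
      _ = A₁ / c * c := by field_simp
      _ ≤ A₁ / c * C.height z ^ (1 - σ + ε) := by
        gcongr
        exact hcK z hzK
      _ ≤ _ := by
        gcongr
        linarith
  · refine (h₂ 𝔟 w hw).trans ?_
    rw [C.height_eq_of_two_le hΓ.discrete 𝔟 w (by linarith)] at hp ⊢
    gcongr
    have : 0 ≤ A₁ / c := by positivity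
    linarith

end Series

theorem proposition3p3 (Γ : Subgroup SL(2, ℝ)) (hΓ : IsCofiniteFuchsian Γ)
    {ι : Type*} [Finite ι] (C : CuspSystem Γ ι)
    (f g : CuspForm (glImage Γ) 2) (m n : ℕ) (hmn : (m, n) ≠ (0, 0)) :
    (∀ (𝔞 : ι) (χ : Γ →* Circle), (∀ τ ∈ C.stab 𝔞, χ τ = 1) →
      -- the summand depends only on the coset of `γ`
      (∀ τ ∈ C.stab 𝔞, ∀ (γ : Γ) (z : ℍ) (s : ℂ),
        eisensteinSummand C f g χ m n 𝔞 (τ * γ) z s = eisensteinSummand C f g χ m n 𝔞 γ z s) ∧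
      -- absolute convergence
      (∀ (z : ℍ) (s : ℂ), 1 < s.re →
        Summable fun q : CuspCoset C 𝔞 ↦ ‖eisensteinTerm C f g χ m n 𝔞 q z s‖) ∧
      -- uniform convergence
      (∀ K : Set ℍ, IsCompact K → ∀ δ : ℝ, 0 < δ →
        TendstoUniformlyOn
          (fun (T : Finset (CuspCoset C 𝔞)) (p : ℍ × ℂ) ↦
            ∑ q ∈ T, eisensteinTerm C f g χ m n 𝔞 q p.1 p.2)
          (fun p ↦ higherEisenstein C f g χ m n 𝔞 p.1 p.2)
          atTop (K ×ˢ {s : ℂ | 1 + δ ≤ s.re})) ∧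
      -- smoothness in `z`
      (∀ s : ℂ, 1 < s.re →
        ContDiffOn ℝ ∞ (fun w : ℂ ↦ higherEisenstein C f g χ m n 𝔞 (ofComplex w) s)
          {w : ℂ | 0 < w.im}) ∧
      -- holomorphy in `s`
      (∀ z : ℍ, DifferentiableOn ℂ (fun s ↦ higherEisenstein C f g χ m n 𝔞 z s)
        {s : ℂ | 1 < s.re})) ∧
    -- growth on the fundamental domain
    (∀ F : Set ℍ, C.IsFundamentalDomain F → ∀ σ : ℝ, 1 < σ → ∀ ε : ℝ, 0 < ε →
      ∃ A : ℝ, ∀ (𝔞 : ι) (χ : Γ →* Circle), (∀ τ ∈ C.stab 𝔞, χ τ = 1) →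
        ∀ s : ℂ, s.re = σ → ∀ z ∈ F,
          ‖higherEisenstein C f g χ m n 𝔞 z s‖ ≤ A * C.height z ^ (1 - σ + ε)) := by
  refine ⟨fun 𝔞 χ hχ ↦ ⟨fun τ hτ γ z s ↦ eisensteinSummand_stab_mul hΓ C f g m n hχ hτ γ z s,
    fun z s hs ↦ summable_norm_eisensteinTerm hΓ C f g χ hmn 𝔞 z hs,
    fun K hK δ hδ ↦ tendstoUniformlyOn_eisenstein hΓ C f g χ hmn 𝔞 hK hδ,
    fun s hs ↦ contDiffOn_higherEisenstein hΓ C f g χ hmn 𝔞 hs,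
    fun z ↦ differentiableOn_higherEisenstein hΓ C f g χ hmn 𝔞 z⟩, fun F hF σ hσ ε hε ↦ ?_⟩
  choose A hA using exists_norm_higherEisenstein_le hΓ C f g hmn hF hσ hε
  -- There are finitely many cusps, so one constant serves all of them.
  obtain ⟨B, hB⟩ := (Set.finite_range A).bddAbove
  exact ⟨B, fun 𝔞 χ _ s hs z hz ↦ (hA 𝔞 χ s hs z hz).trans (mul_le_mul_of_nonneg_right
    (hB ⟨𝔞, rfl⟩) (Real.rpow_nonneg (C.height_pos 𝔞 z).le _))⟩
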